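/- Let $(C,T_1,T_2,\dots)$ be a sequence of real random variables with $T_1\ge T_2\ge\dots\ge 0$ a.s., and suppose that $N:=\sum_{k\ge1}\mathbf 1_{\{T_k\ne0\}}$ is a.s. finite. Let $\Sigma_\alpha:=\sum_{k=1}^N T_k^\alpha$ for $\alpha>0$. Let $(C(v),T_1(v),T_2(v),\dots)$, $v\in\{\varnothing\}\cup\bigcup_{n\ge1}\mathbb N^n$, be independent copies of $(C,T_1,T_2,\dots)$, let $L(\varnothing):=1$ and $L(v_1\dots v_n):=\prod_{i=1}^n T_{v_i}(v_1\dots v_{i-1})$, and put $W_n:=\sum_{k=0}^n\sum_{|v|=k}L(v)C(v)$. Assume that, for some $p\in[1,2]$, $$\mathbb E C=0,\qquad \mathbb E|C|^p<\infty\qquad\text{and}\qquad \mathbb E\,\Sigma_p<1,$$ that $\mathbb E C^2<\infty$, that $\max_{1\le k\le N}T_k\le1$ a.s., that $\|\Sigma_2\|_\infty<\infty$, and that $$\Big\|\max_{2\le k\le N}T_k\Big\|_\infty<1\qquad\text{and}\qquad \mathbb P[T_1=1,\ N\ge2]=0 .$$ Then $W_n$ converges a.s. to a random variable $W$ (the canonical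 solution of $X\stackrel d=\sum_{k\ge1}T_kX_k+C$), and $$\{\theta\in\mathbb R:\mathbb E e^{\theta W}<\infty\}=\{\theta\in\mathbb R:\mathbb E e^{\theta C}<\infty\}\cap\{\theta\in\mathbb R: a(\theta)<1\},\qquad a(\theta):=\mathbb E\big[e^{\theta C}\mathbf 1_{\{T_1=1\}}\big].$$ -/

import Mathlib

open MeasureTheory ProbabilityTheory Filter Topology

namespace SmoothingTransform

noncomputable section

/- Weight sequences `T` are indexed by `ℕ`, so that `T 0`, `T 1`, ... are the weights
`T_1`, `T_2`, ... of the mathematical text. -/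

/-- The number `N` of nonzero weights. -/
def numNonzero {Ω : Type*} (T : ℕ → Ω → ℝ) (ω : Ω) : ℕ∞ :=
  {k : ℕ | T k ω ≠ 0}.encard

/-- The power sum `Σ_α = ∑_k |T_k| ^ α` for an exponent `α > 0` (zero weights contribute
nothing), with values in `[0, ∞]`. -/
def powerSum {Ω : Type*} (T : ℕ → Ω → ℝ) (α : ℝ) (ω : Ω) : ENNReal :=
  ∑' k : ℕ, ‖T k ω‖ₑ ^ α

/-- `a(θ) = E[exp (θ C); T_1 = 1]`, with values in `[0, ∞]`. -/
def unitWeightMGF {Ω : Type*} [MeasurableSpace Ω] (P : Measure Ω)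
    (C : Ω → ℝ) (T : ℕ → Ω → ℝ) (θ : ℝ) : ENNReal :=
  ∫⁻ ω in {ω | T 0 ω = 1}, ENNReal.ofReal (Real.exp (θ * C ω)) ∂P

/-- The data `(C(v), T_1(v), T_2(v), ...)`, with `v` ranging over the vertices of the infinite
Ulam-Harris tree, are independent copies of `(C, T_1, T_2, ...)`.

A vertex `v_1 v_2 ... v_n` is encoded by the list `[v_n, ..., v_2, v_1]`: the root is `[]`, and
`k :: v` is the `k`-th child of `v`. -/
structure IsBranchingModel {Ω₀ Ω : Type*} [MeasurableSpace Ω₀] [MeasurableSpace Ω]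
    (P₀ : Measure Ω₀) (C : Ω₀ → ℝ) (T : ℕ → Ω₀ → ℝ)
    (P : Measure Ω) (CC : List ℕ → Ω → ℝ) (TT : List ℕ → ℕ → Ω → ℝ) : Prop where
  measurable_C : ∀ v, Measurable (CC v)
  measurable_T : ∀ v k, Measurable (TT v k)
  indep : iIndepFun (fun (v : List ℕ) (ω : Ω) => (CC v ω, fun k : ℕ => TT v k ω)) P
  identDistrib : ∀ v : List ℕ,
    IdentDistrib (fun ω : Ω => (CC v ω, fun k : ℕ => TT v k ω))
      (fun ω : Ω₀ => (C ω, fun k : ℕ => T k ω)) P P₀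

/-- The total weight `L(v)` of the branch from the root to `v`: the product of the weights of the
edges along this branch, where `TT v k` is the weight of the edge from `v` to its `k`-th child. -/
def branchWeight {Ω : Type*} (TT : List ℕ → ℕ → Ω → ℝ) : List ℕ → Ω → ℝ
  | [], _ => 1
  | k :: v, ω => branchWeight TT v ω * TT v k ω

/-- `∑_{|v| = n} L(v) C(v)`; only finitely many summands are nonzero if every vertex has only
finitely many nonzero weights. -/
def generationSum {Ω : Type*} (CC : List ℕ → Ω → ℝ) (TT : List ℕ → ℕ → Ω → ℝ)
    (n : ℕ) (ω : Ω) : ℝ :=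
  ∑' v : {v : List ℕ // v.length = n}, branchWeight TT v.1 ω * CC v.1 ω

/-- `W_n = ∑_{k ≤ n} ∑_{|v| = k} L(v) C(v)`. -/
def partialSolution {Ω : Type*} (CC : List ℕ → Ω → ℝ) (TT : List ℕ → ℕ → Ω → ℝ)
    (n : ℕ) (ω : Ω) : ℝ :=
  ∑ k ∈ Finset.range (n + 1), generationSum CC TT k ω

/-- The canonical solution `W = lim W_n`. -/
def canonicalSolution {Ω : Type*} (CC : List ℕ → Ω → ℝ) (TT : List ℕ → ℕ → Ω → ℝ)
    (ω : Ω) : ℝ :=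
  limUnder atTop (fun n : ℕ => partialSolution CC TT n ω)

end

end SmoothingTransform

namespace SmoothingTransform

/-! Let E(θ) be the moment generating function of W. Since W = C + ∑ T_k W_k with independent copies
W_k of W, conditioning on the root gives E(θ) = 𝔼[exp(θC) ∏ E(θ T_k)], and E ≥ 1 because W is
centred.

Necessity (`lintegral_exp_ne_top_and_unitWeightMGF_lt_one`). Dropping all factors gives 𝔼 exp(θC) ≤
E(θ). Keeping the factor of T_1 on {T_1 = 1} gives E(θ) ≥ a(θ) E(θ) + 𝔼[exp(θC); T_1 ≠ 1]. The last
term is positive, because 𝔼 Σ_2 < 1 forces P(T_1 = 1) < 1; so E(θ) < ∞ forces a(θ) < 1.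

Sufficiency. The moment generating functions φ n s of the iterates, taken at sθ, are bounded
uniformly in n up to s = 1, and Fatou's lemma concludes. Near s = 0 the bound exp(K s²) reproduces
itself under the recursion, because 𝔼 Σ_2 < 1 (`exists_le_exp_sq`). All weights but the first are at
most some β < 1, so a bound at βs controls every factor but the first at s. What remains is φ (n+1)
s ≤ ρ φ n s + D, where {T_1 = 1} contributes at most max(P(T_1 = 1), a(θ)) < 1 to ρ, the event that
T_1 is slightly below 1 contributes little, and smaller T_1 only enter D (`exists_bound_extend`).
Finitely many such extensions reach s = 1 (`exists_bound_one`).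

Convergence holds because generation n has second moment (𝔼 Σ_2)^n 𝔼 C², so the L¹ norms are
summable. The probabilistic part lives on the product space of marked trees, where the subtrees of
the root are i.i.d. (`measurePreserving_root_subtree`). -/

/-! ### Elementary exponential inequalities and the small-parameter estimate -/

theorem exp_le_one_add_add_sq {x : ℝ} (hx : x ≤ 1) : Real.exp x ≤ 1 + x + x ^ 2 := by
  rcases le_or_gt (-1) x with h | h
  · have := (abs_le.1 (Real.abs_exp_sub_one_sub_id_le (abs_le.2 ⟨h, hx⟩))).2
    linarith
  · have : Real.exp x ≤ 1 := Real.exp_le_one_iff.2 (by linarith)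
    nlinarith

/-- For s * c ≤ 1 this is Taylor's bound. Otherwise 1 < s² c² and s * c ≤ c / 2, and c² ≤ 4 exp (c /
2) turns s² c² exp (c / 2) into 4 s² exp c. The remainder is integrable using only a second moment
and the one-sided moment exp c. -/
theorem exp_mul_le_second_order {s c : ℝ} (hs : 0 ≤ s) (hs' : s ≤ 1 / 2) :
    Real.exp (s * c) ≤ 1 + s * c + s ^ 2 * (c ^ 2 + 4 * Real.exp c) := by
  have he := Real.exp_pos c
  rcases le_or_gt (s * c) 1 with h | h
  · have := exp_le_one_add_add_sq h
    nlinarith [mul_nonneg (sq_nonneg s) he.le]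
  · have hc : 0 < c := by
      by_contra hc
      nlinarith [mul_nonneg hs (by linarith : 0 ≤ -c)]
    have h1 : Real.exp (s * c) ≤ Real.exp (c / 2) := Real.exp_le_exp.2 (by nlinarith)
    have h2 : c ^ 2 ≤ 4 * Real.exp (c / 2) := by
      have h3 := Real.quadratic_le_exp_of_nonneg (x := c / 4) (by positivity)
      have h4 : Real.exp (c / 2) = Real.exp (c / 4) ^ 2 := by
        rw [← Real.exp_nat_mul]; congr 1; push_cast; ring
      have h5 : c / 2 ≤ Real.exp (c / 4) := by nlinarith [sq_nonneg (c / 4 - 1)]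
      rw [h4]
      nlinarith
    have h6 : Real.exp c = Real.exp (c / 2) ^ 2 := by
      rw [← Real.exp_nat_mul]; congr 1; push_cast; ring
    have h7 : 1 ≤ s ^ 2 * c ^ 2 := by nlinarith
    have h8 : s ^ 2 * c ^ 2 * Real.exp (c / 2) ≤ s ^ 2 * (4 * Real.exp c) := by
      rw [h6, mul_assoc]
      apply mul_le_mul_of_nonneg_left _ (sq_nonneg s)
      nlinarith [Real.exp_pos (c / 2)]
    nlinarith [Real.exp_pos (c / 2)]

theorem exp_mul_le_convex_comb {s c : ℝ} (hs : 0 ≤ s) (hs' : s ≤ 1) :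
    Real.exp (s * c) ≤ (1 - s) + s * Real.exp c := by
  have := convexOn_exp.2 (Set.mem_univ (0 : ℝ)) (Set.mem_univ c) (sub_nonneg.2 hs') hs (by ring)
  simpa using this

theorem exp_le_one_add_mul_exp {u : ℝ} : Real.exp u ≤ 1 + u * Real.exp u := by
  have h := Real.add_one_le_exp (-u)
  have h2 : Real.exp (-u) * Real.exp u = 1 := by rw [← Real.exp_add]; simp
  nlinarith [Real.exp_pos u]

theorem lintegral_ofReal_le_ofReal_integral {Ω : Type*} [MeasurableSpace Ω] {μ : Measure Ω}
    {f g : Ω → ℝ} (hg : Integrable g μ) (hf : ∀ᵐ ω ∂μ, 0 ≤ f ω) (hfg : ∀ᵐ ω ∂μ, f ω ≤ g ω) :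
    ∫⁻ ω, ENNReal.ofReal (f ω) ∂μ ≤ ENNReal.ofReal (∫ ω, g ω ∂μ) := by
  rw [ofReal_integral_eq_lintegral_ofReal hg]
  · exact lintegral_mono_ae (hfg.mono fun ω h => ENNReal.ofReal_le_ofReal h)
  · filter_upwards [hf, hfg] with ω h1 h2 using h1.trans h2

/-- An exponential bound for `C` perturbed by a small multiple of the bounded variable `V`. -/
theorem exists_lintegral_exp_add_le {Ω : Type*} [MeasurableSpace Ω] (μ : Measure Ω)
    [IsProbabilityMeasure μ] {C V : Ω → ℝ} (hV : AEMeasurable V μ) {M : ℝ}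
    (hV0 : ∀ᵐ ω ∂μ, 0 ≤ V ω) (hVM : ∀ᵐ ω ∂μ, V ω ≤ M) (hV1 : ∫ ω, V ω ∂μ < 1)
    (hCm : ∫ ω, C ω ∂μ = 0) (hC : MemLp C 2 μ) (hexp : Integrable (fun ω => Real.exp (C ω)) μ) :
    ∃ K : ℝ, 0 ≤ K ∧ ∃ s₀ : ℝ, 0 < s₀ ∧ s₀ ≤ 1 ∧ ∀ s, 0 ≤ s → s ≤ s₀ →
      ∫⁻ ω, ENNReal.ofReal (Real.exp (s * C ω)) * ENNReal.ofReal (Real.exp (K * s ^ 2 * V ω)) ∂μ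
        ≤ ENNReal.ofReal (Real.exp (K * s ^ 2)) := by
  have hC1 : Integrable C μ := hC.integrable one_le_two
  have hVi : Integrable V μ := by
    refine Integrable.of_bound hV.aestronglyMeasurable M ?_
    filter_upwards [hV0, hVM] with ω h0 h1
    rwa [Real.norm_of_nonneg h0]
  have hM : 0 ≤ M := by
    obtain ⟨ω, h0, h1⟩ := (hV0.and hVM).exists
    exact h0.trans h1
  set v := ∫ ω, V ω ∂μ with hv
  set m := ∫ ω, Real.exp (C ω) ∂μ with hm
  set c := ∫ ω, (C ω ^ 2 + 4 * Real.exp (C ω)) ∂μ with hc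
  have hDi : Integrable (fun ω => C ω ^ 2 + 4 * Real.exp (C ω)) μ :=
    hC.integrable_sq.add (hexp.const_mul 4)
  have hc0 : 0 ≤ c := integral_nonneg fun ω => by positivity
  have hq1 : 0 < 1 - (1 + v) / 2 := by linarith
  -- K solves c + K (1 + v) / 2 = K: the second-order cost c of `C` plus the share of K passed on by
  -- the weights, with (1 + v) / 2 leaving room above v for the errors of positive s.
  set K := c / (1 - (1 + v) / 2) with hK
  have hK0 : 0 ≤ K := by positivity
  have hcont : Tendsto (fun s : ℝ => Real.exp (K * s ^ 2 * M) * (v + s * (M * m))) (𝓝 0)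
      (𝓝 (Real.exp (K * 0 ^ 2 * M) * (v + 0 * (M * m)))) := by
    apply Continuous.tendsto; fun_prop
  have hev := hcont.eventually_lt_const (u := (1 + v) / 2) (by simp; linarith)
  obtain ⟨ε, hε, hball⟩ := Metric.eventually_nhds_iff.1 hev
  refine ⟨K, hK0, min (ε / 2) (1 / 2), by positivity, (min_le_right _ _).trans (by norm_num), ?_⟩
  intro s hs hs'
  have hs2 : s ≤ 1 / 2 := hs'.trans (min_le_right _ _)
  have hsq : Real.exp (K * s ^ 2 * M) * (v + s * (M * m)) ≤ (1 + v) / 2 := by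
    apply le_of_lt
    apply hball
    rw [Real.dist_eq, sub_zero, abs_of_nonneg hs]
    linarith [hs'.trans (min_le_left _ _)]
  simp_rw [← ENNReal.ofReal_mul (Real.exp_pos _).le]
  -- In the majorant exp (s C) is expanded to second order, and exp (K s² V) to first order. The
  -- dependence between `C` and `V` is removed by exp (s C) V ≤ V + s M exp C, an error of order s.
  -- The linear term s C integrates to zero.
  refine (lintegral_ofReal_le_ofReal_integral
    (g := fun ω => (1 + s * C ω + s ^ 2 * (C ω ^ 2 + 4 * Real.exp (C ω))) +
      K * s ^ 2 * Real.exp (K * s ^ 2 * M) * (V ω + s * (M * Real.exp (C ω)))) ?_ ?_ ?_).trans ?_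
  · exact (((integrable_const 1).add (hC1.const_mul s)).add (hDi.const_mul _)).add
      ((hVi.add ((hexp.const_mul M).const_mul s)).const_mul _)
  · exact Eventually.of_forall fun ω => by positivity
  · filter_upwards [hV0, hVM] with ω h0 h1
    have e1 := exp_mul_le_second_order (c := C ω) hs hs2
    have e2 := exp_mul_le_convex_comb (c := C ω) hs (by linarith)
    have e3 := exp_le_one_add_mul_exp (u := K * s ^ 2 * V ω)
    have e4 : Real.exp (K * s ^ 2 * V ω) ≤ Real.exp (K * s ^ 2 * M) :=
      Real.exp_le_exp.2 (mul_le_mul_of_nonneg_left h1 (by positivity))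
    have e5 : Real.exp (s * C ω) * V ω ≤ V ω + s * (M * Real.exp (C ω)) := by
      calc Real.exp (s * C ω) * V ω ≤ (1 - s + s * Real.exp (C ω)) * V ω :=
            mul_le_mul_of_nonneg_right e2 h0
        _ ≤ V ω + s * (V ω * Real.exp (C ω)) := by nlinarith
        _ ≤ _ := by gcongr
    calc Real.exp (s * C ω) * Real.exp (K * s ^ 2 * V ω)
        ≤ Real.exp (s * C ω) * (1 + K * s ^ 2 * V ω * Real.exp (K * s ^ 2 * M)) := by
          gcongr
          exact e3.trans (by gcongr)
      _ = Real.exp (s * C ω) +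
            K * s ^ 2 * Real.exp (K * s ^ 2 * M) * (Real.exp (s * C ω) * V ω) := by ring
      _ ≤ _ := by gcongr
  · apply ENNReal.ofReal_le_ofReal
    have hint : ∫ ω, (1 + s * C ω + s ^ 2 * (C ω ^ 2 + 4 * Real.exp (C ω))) +
        K * s ^ 2 * Real.exp (K * s ^ 2 * M) * (V ω + s * (M * Real.exp (C ω))) ∂μ
        = 1 + s ^ 2 * c + K * s ^ 2 * Real.exp (K * s ^ 2 * M) * (v + s * (M * m)) := by
      have i1 : Integrable (fun ω => s * C ω) μ := hC1.const_mul s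
      have i2 : Integrable (fun ω => 1 + s * C ω) μ := (integrable_const 1).add i1
      have i3 : Integrable (fun ω => s ^ 2 * (C ω ^ 2 + 4 * Real.exp (C ω))) μ := hDi.const_mul _
      have i4 : Integrable (fun ω => s * (M * Real.exp (C ω))) μ := (hexp.const_mul M).const_mul s
      have i5 : Integrable (fun ω => V ω + s * (M * Real.exp (C ω))) μ := hVi.add i4
      have i6 : Integrable (fun ω => 1 + s * C ω + s ^ 2 * (C ω ^ 2 + 4 * Real.exp (C ω))) μ :=
        i2.add i3
      rw [integral_add i6 (i5.const_mul _), integral_add i2 i3,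
        integral_add (integrable_const 1) i1, integral_const_mul, integral_const_mul,
        integral_const_mul, integral_add hVi i4, integral_const_mul, integral_const_mul, hCm]
      simp [hc, hv, hm]
    rw [hint]
    have hKc : c + K * ((1 + v) / 2) = K := by
      have : K * (1 - (1 + v) / 2) = c := div_mul_cancel₀ c hq1.ne'
      linarith
    calc _ = 1 + s ^ 2 * c + K * s ^ 2 * (Real.exp (K * s ^ 2 * M) * (v + s * (M * m))) := by ring
      _ ≤ 1 + s ^ 2 * c + K * s ^ 2 * ((1 + v) / 2) := by gcongr
      _ = K * s ^ 2 + 1 := by linear_combination s ^ 2 * hKc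
      _ ≤ _ := Real.add_one_le_exp _

/-! ### The recursion for moment generating functions and its bound near zero -/

/-- Nonnegative weights bounded by `1`, of which only the zeroth can be close to `1`, whose squares
have a bounded sum `V` of mean less than `1`. -/
structure IsDampedWeight {Ω : Type*} [MeasurableSpace Ω] (P : Measure Ω)
    (T : ℕ → Ω → ℝ) (V : Ω → ℝ) (M β : ℝ) : Prop where
  measurable : ∀ k, Measurable (T k)
  nonneg : ∀ᵐ ω ∂P, ∀ k, 0 ≤ T k ω
  le_one : ∀ᵐ ω ∂P, ∀ k, T k ω ≤ 1
  tail_le : ∀ᵐ ω ∂P, ∀ k, T (k + 1) ω ≤ β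
  tail_eq_zero : ∀ᵐ ω ∂P, T 0 ω = 1 → ∀ k, T (k + 1) ω = 0
  sum_sq_le : ∀ᵐ ω ∂P, ∀ N, ∑ k ∈ Finset.range N, T k ω ^ 2 ≤ V ω
  aemeasurable_sum : AEMeasurable V P
  sum_le : ∀ᵐ ω ∂P, V ω ≤ M
  integral_sum_lt : ∫ ω, V ω ∂P < 1

/-- The recursion satisfied by the moment generating functions of the iterates of a smoothing
transform, started at `0`. -/
structure IsMGFRecursion {Ω : Type*} [MeasurableSpace Ω] (P : Measure Ω)
    (C : Ω → ℝ) (T : ℕ → Ω → ℝ) (φ : ℕ → ℝ → ENNReal) : Prop where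
  zero : ∀ s, φ 0 s = 1
  one_le : ∀ n s, 1 ≤ φ n s
  mono : ∀ n s t, 0 ≤ t → t ≤ 1 → φ n (t * s) ≤ φ n s
  succ : ∀ n s, φ (n + 1) s = ∫⁻ ω, ENNReal.ofReal (Real.exp (s * C ω)) *
    ⨆ N, ∏ k ∈ Finset.range N, φ n (s * T k ω) ∂P

theorem prod_le_exp_sum {ψ : ℝ → ENNReal} {K s v : ℝ} {N : ℕ} {t : ℕ → ℝ} (hK : 0 ≤ K)
    (h : ∀ k, ψ (s * t k) ≤ ENNReal.ofReal (Real.exp (K * (s * t k) ^ 2)))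
    (hv : ∑ k ∈ Finset.range N, t k ^ 2 ≤ v) :
    ∏ k ∈ Finset.range N, ψ (s * t k) ≤ ENNReal.ofReal (Real.exp (K * s ^ 2 * v)) := by
  calc ∏ k ∈ Finset.range N, ψ (s * t k)
      ≤ ∏ k ∈ Finset.range N, ENNReal.ofReal (Real.exp (K * (s * t k) ^ 2)) :=
        Finset.prod_le_prod' fun k _ => h k
    _ = ENNReal.ofReal (Real.exp (K * s ^ 2 * ∑ k ∈ Finset.range N, t k ^ 2)) := by
        rw [← ENNReal.ofReal_prod_of_nonneg fun _ _ => (Real.exp_pos _).le, ← Real.exp_sum,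
          Finset.mul_sum]
        simp_rw [mul_pow, mul_assoc]
    _ ≤ _ := by gcongr

/-- The bound is the fixed point D / (1 - ρ), raised by 1 to cover the initial value. Finiteness of
each x n comes out of the induction and need not be known beforehand. -/
theorem exists_bound_of_affine_recursion {x : ℕ → ENNReal} {ρ D : ENNReal} (hρ : ρ < 1)
    (hD : D ≠ ⊤) (h0 : x 0 ≤ 1) (h : ∀ n, x (n + 1) ≤ ρ * x n + D) :
    ∃ B : ℝ, ∀ n, x n ≤ ENNReal.ofReal B := by
  lift ρ to NNReal using hρ.ne_top
  lift D to NNReal using hD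
  have hρ' : (ρ : ℝ) < 1 := by exact_mod_cast hρ
  refine ⟨1 + D / (1 - ρ), fun n => ?_⟩
  have hd : (0 : ℝ) ≤ D / (1 - ρ) := div_nonneg D.2 (by linarith)
  induction n with
  | zero => exact h0.trans (by rw [← ENNReal.ofReal_one]; exact ENNReal.ofReal_le_ofReal (by linarith))
  | succ n ih =>
    refine (h n).trans ?_
    calc (ρ : ENNReal) * x n + D ≤ ρ * ENNReal.ofReal (1 + D / (1 - ρ)) + D := by gcongr
      _ = ENNReal.ofReal (ρ * (1 + D / (1 - ρ)) + D) := by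
        rw [ENNReal.ofReal_add (mul_nonneg ρ.coe_nonneg (by linarith)) D.coe_nonneg,
          ENNReal.ofReal_mul ρ.coe_nonneg,
          ENNReal.ofReal_coe_nnreal]
        simp
      _ ≤ _ := by
        apply ENNReal.ofReal_le_ofReal
        have h1 : (1 - (ρ : ℝ)) ≠ 0 := by linarith
        have : (D : ℝ) = D / (1 - ρ) * (1 - ρ) := by field_simp
        nlinarith

namespace IsMGFRecursion

variable {Ω : Type*} [MeasurableSpace Ω] {P : Measure Ω}
  {C : Ω → ℝ} {T : ℕ → Ω → ℝ} {φ : ℕ → ℝ → ENNReal} {V : Ω → ℝ} {M β : ℝ}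

/-- Weights at most 1 keep s * T k in [0, s₀], so the induction hypothesis applies to every factor
and bounds the product by exp (K s² V). `exists_lintegral_exp_add_le` then returns the same K. -/
theorem exists_le_exp_sq [IsProbabilityMeasure P] (hφ : IsMGFRecursion P C T φ) (hT : IsDampedWeight P T V M β)
    (hCm : ∫ ω, C ω ∂P = 0) (hC : MemLp C 2 P) (hexp : Integrable (fun ω => Real.exp (C ω)) P) :
    ∃ K : ℝ, 0 ≤ K ∧ ∃ s₀ : ℝ, 0 < s₀ ∧ s₀ ≤ 1 ∧ ∀ n s, 0 ≤ s → s ≤ s₀ →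
      φ n s ≤ ENNReal.ofReal (Real.exp (K * s ^ 2)) := by
  obtain ⟨K, hK, s₀, hs₀, hs₀', h⟩ := exists_lintegral_exp_add_le P hT.aemeasurable_sum
    (hT.sum_sq_le.mono fun ω h => by simpa using h 0) hT.sum_le hT.integral_sum_lt hCm hC hexp
  refine ⟨K, hK, s₀, hs₀, hs₀', fun n => ?_⟩
  induction n with
  | zero =>
    intro s _ _
    rw [hφ.zero, ← ENNReal.ofReal_one]
    exact ENNReal.ofReal_le_ofReal (Real.one_le_exp (by positivity))
  | succ n ih =>
    intro s hs hs'
    rw [hφ.succ]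
    refine (lintegral_mono_ae ?_).trans (h s hs hs')
    filter_upwards [hT.nonneg, hT.le_one, hT.sum_sq_le] with ω h0 h1 h2
    gcongr
    exact iSup_le fun N => prod_le_exp_sum (t := fun k => T k ω) hK
      (fun k => ih _ (mul_nonneg hs (h0 k)) ((mul_le_of_le_one_right hs (h1 k)).trans hs')) (h2 N)

theorem exists_bound_mono (hφ : IsMGFRecursion P C T φ) {s s' : ℝ} (hs : 0 ≤ s) (hss : s ≤ s')
    (h : ∃ B : ℝ, ∀ n, φ n s' ≤ ENNReal.ofReal B) : ∃ B : ℝ, ∀ n, φ n s ≤ ENNReal.ofReal B := by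
  obtain ⟨B, hB⟩ := h
  refine ⟨B, fun n => le_trans ?_ (hB n)⟩
  rcases hs.eq_or_lt with rfl | h0
  · simpa using hφ.mono n s' 0 le_rfl zero_le_one
  · have hs' := h0.trans_le hss
    have := hφ.mono n s' (s / s') (by positivity) (div_le_one_of_le₀ hss hs'.le)
    rwa [div_mul_cancel₀ _ hs'.ne'] at this

end IsMGFRecursion

/-! ### Exponential moments restricted to events -/

theorem setLIntegral_exp_mul_le {Ω : Type*} [MeasurableSpace Ω] (P : Measure Ω)
    {C : Ω → ℝ} (hC : Measurable C) {s : ℝ} (hs : 0 ≤ s) (hs' : s ≤ 1) (A : Set Ω) :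
    ∫⁻ ω in A, ENNReal.ofReal (Real.exp (s * C ω)) ∂P ≤
      ENNReal.ofReal (1 - s) * P A +
        ENNReal.ofReal s * ∫⁻ ω in A, ENNReal.ofReal (Real.exp (C ω)) ∂P := by
  calc _ ≤ ∫⁻ ω in A, (ENNReal.ofReal (1 - s) +
        ENNReal.ofReal s * ENNReal.ofReal (Real.exp (C ω))) ∂P := by
        refine lintegral_mono fun ω => ?_
        rw [← ENNReal.ofReal_mul hs, ← ENNReal.ofReal_add (sub_nonneg.2 hs') (by positivity)]
        exact ENNReal.ofReal_le_ofReal (exp_mul_le_convex_comb hs hs')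
    _ = _ := by
        rw [lintegral_add_left measurable_const, lintegral_const_mul _ (by fun_prop),
          setLIntegral_const]

/-- A convex function of s on [0, 1] is at most the larger of its endpoint values. With A = {T 0 =
1}, this carries the hypothesis a(θ) < 1 over to all sθ. -/
theorem setLIntegral_exp_mul_le_max {Ω : Type*} [MeasurableSpace Ω] (P : Measure Ω)
    {C : Ω → ℝ} (hC : Measurable C) {s : ℝ} (hs : 0 ≤ s) (hs' : s ≤ 1) (A : Set Ω) :
    ∫⁻ ω in A, ENNReal.ofReal (Real.exp (s * C ω)) ∂P ≤
      max (P A) (∫⁻ ω in A, ENNReal.ofReal (Real.exp (C ω)) ∂P) := by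
  refine (setLIntegral_exp_mul_le P hC hs hs' A).trans ?_
  set m := max (P A) (∫⁻ ω in A, ENNReal.ofReal (Real.exp (C ω)) ∂P)
  calc _ ≤ ENNReal.ofReal (1 - s) * m + ENNReal.ofReal s * m := by
        gcongr
        exacts [le_max_left _ _, le_max_right _ _]
    _ = m := by
        rw [← add_mul, ← ENNReal.ofReal_add (sub_nonneg.2 hs') hs]
        simp

/-- The sets {1 - ε < X < 1} decrease to the empty set as ε → 0. Convexity dominates the integrals
for all s at once by the finite measure P + exp(C) P, so ε does not depend on s. -/
theorem exists_setLIntegral_near_one_lt {Ω : Type*} [MeasurableSpace Ω] (P : Measure Ω)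
    [IsProbabilityMeasure P] {C X : Ω → ℝ} (hC : Measurable C) (hX : Measurable X)
    (hexp : ∫⁻ ω, ENNReal.ofReal (Real.exp (C ω)) ∂P ≠ ⊤) {δ : ENNReal} (hδ : 0 < δ) :
    ∃ ε : ℝ, 0 < ε ∧ ε < 1 ∧ ∀ s, 0 ≤ s → s ≤ 1 →
      ∫⁻ ω in {ω | 1 - ε < X ω ∧ X ω < 1}, ENNReal.ofReal (Real.exp (s * C ω)) ∂P < δ := by
  have hmeas : Measurable fun ω => ENNReal.ofReal (Real.exp (C ω)) := by fun_prop
  set ν : Measure Ω := P + P.withDensity fun ω => ENNReal.ofReal (Real.exp (C ω)) with hν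
  have : IsFiniteMeasure (P.withDensity fun ω => ENNReal.ofReal (Real.exp (C ω))) :=
    isFiniteMeasure_withDensity hexp
  -- With j + 2 in place of j + 1, ε < 1 holds even for j = 0.
  set A : ℕ → Set Ω := fun j => {ω | 1 - 1 / ((j : ℝ) + 2) < X ω ∧ X ω < 1} with hA
  have hAm : ∀ j, MeasurableSet (A j) := fun j =>
    (measurableSet_lt measurable_const hX).inter (measurableSet_lt hX measurable_const)
  have hanti : Antitone A := by
    intro i j hij ω hω
    refine ⟨lt_of_le_of_lt ?_ hω.1, hω.2⟩
    have : (i : ℝ) ≤ j := by exact_mod_cast hij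
    gcongr
  have hlim := tendsto_measure_iInter_atTop (μ := ν) (fun j => (hAm j).nullMeasurableSet) hanti
    ⟨0, measure_ne_top _ _⟩
  have hempty : ⋂ j, A j = ∅ := by
    ext ω
    simp only [Set.mem_iInter, Set.mem_empty_iff_false, iff_false, not_forall]
    by_contra! hcon
    have h1 : 0 < 1 - X ω := by linarith [(hcon 0).2]
    obtain ⟨n, hn⟩ := exists_nat_one_div_lt h1
    have h2 := (hcon n).1
    have h3 : 1 / ((n : ℝ) + 2) ≤ 1 / ((n : ℝ) + 1) := by gcongr; norm_num
    linarith
  rw [hempty, measure_empty] at hlim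
  obtain ⟨j, hj⟩ := (hlim.eventually_lt_const hδ).exists
  have hjpos : (0 : ℝ) < j + 2 := by positivity
  refine ⟨1 / ((j : ℝ) + 2), by positivity, ?_, fun s hs hs' => ?_⟩
  · rw [div_lt_one hjpos]; linarith [(Nat.cast_nonneg j : (0 : ℝ) ≤ j)]
  refine lt_of_le_of_lt (setLIntegral_exp_mul_le P hC hs hs' (A j)) (lt_of_le_of_lt ?_ hj)
  rw [Function.comp_apply, hν, Measure.add_apply, withDensity_apply _ (hAm j)]
  gcongr
  · exact mul_le_of_le_one_left' (ENNReal.ofReal_le_one.2 (by linarith))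
  · exact mul_le_of_le_one_left' (ENNReal.ofReal_le_one.2 hs')

/-! ### Extending the bound to larger parameters -/

namespace IsMGFRecursion

variable {Ω : Type*} [MeasurableSpace Ω] {P : Measure Ω}
  {C : Ω → ℝ} {T : ℕ → Ω → ℝ} {φ : ℕ → ℝ → ENNReal} {V : Ω → ℝ} {M β : ℝ}

/-- The weights after the zeroth are at most β, so their factors have arguments in [0, s₁] and
together cost at most exp (K M). On {T 0 = 1} they vanish, and φ n s appears with constant exactly
1; this is what makes a(θ) < 1 the sharp condition. -/
theorem ae_iSup_prod_le (hφ : IsMGFRecursion P C T φ) (hT : IsDampedWeight P T V M β)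
    {K s s₁ : ℝ} (hK : 0 ≤ K) (hs₁ : 0 ≤ s₁) {n : ℕ}
    (hb : ∀ u, 0 ≤ u → u ≤ s₁ → φ n u ≤ ENNReal.ofReal (Real.exp (K * u ^ 2)))
    (hs : 0 ≤ s) (hs' : s ≤ 1) (hsβ : s * β ≤ s₁) :
    ∀ᵐ ω ∂P, (⨆ N, ∏ k ∈ Finset.range N, φ n (s * T k ω) ≤
        φ n (s * T 0 ω) * ENNReal.ofReal (Real.exp (K * M))) ∧
      (T 0 ω = 1 → ⨆ N, ∏ k ∈ Finset.range N, φ n (s * T k ω) ≤ φ n s) := by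
  filter_upwards [hT.nonneg, hT.tail_le, hT.tail_eq_zero, hT.sum_sq_le, hT.sum_le]
    with ω h0 h1 h2 h3 h4
  have hV0 : 0 ≤ V ω := by simpa using h3 0
  constructor
  · refine iSup_le fun N => ?_
    cases N with
    | zero =>
      simp only [Finset.range_zero, Finset.prod_empty]
      refine one_le_mul (hφ.one_le _ _) ?_
      rw [← ENNReal.ofReal_one]
      exact ENNReal.ofReal_le_ofReal (Real.one_le_exp (mul_nonneg hK (hV0.trans h4)))
    | succ N =>
      rw [Finset.prod_range_succ', mul_comm]
      gcongr
      refine (prod_le_exp_sum (t := fun k => T (k + 1) ω) (v := M) hK (fun k => hb _ ?_ ?_)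
        ?_).trans ?_
      · exact mul_nonneg hs (h0 _)
      · exact (mul_le_mul_of_nonneg_left (h1 k) hs).trans hsβ
      · refine le_trans ?_ ((h3 (N + 1)).trans h4)
        rw [Finset.sum_range_succ']
        linarith [sq_nonneg (T 0 ω)]
      · apply ENNReal.ofReal_le_ofReal
        apply Real.exp_le_exp.2
        have : s ^ 2 ≤ 1 := pow_le_one₀ hs hs'
        nlinarith [mul_nonneg hK (hV0.trans h4)]
  · intro h
    refine iSup_le fun N => ?_
    cases N with
    | zero => simpa using hφ.one_le n s
    | succ N =>
      rw [Finset.prod_range_succ', h, mul_one]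
      refine mul_le_of_le_one_left' (Finset.prod_le_one' fun k _ => ?_)
      rw [h2 h k, mul_zero]
      -- At u = 0 the quadratic bound reads φ n 0 ≤ 1.
      simpa using hb 0 le_rfl hs₁

/-- Splitting according to T 0 = 1, 1 - ε < T 0 < 1 and T 0 ≤ 1 - ε yields an affine recursion for φ
n s: the first two events feed its ratio, the third is bounded through φ n ((1 - ε) s). Since ε does
not depend on s, the step can be iterated. -/
theorem exists_bound_extend [IsProbabilityMeasure P] (hφ : IsMGFRecursion P C T φ) (hT : IsDampedWeight P T V M β)
    (hCmeas : Measurable C) (hexp : Integrable (fun ω => Real.exp (C ω)) P)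
    (h_one : P {ω | T 0 ω = 1} < 1) (ha : unitWeightMGF P C T 1 < 1)
    {K s₁ : ℝ} (hK : 0 ≤ K) (hs₁ : 0 ≤ s₁)
    (hb : ∀ n u, 0 ≤ u → u ≤ s₁ → φ n u ≤ ENNReal.ofReal (Real.exp (K * u ^ 2))) :
    ∃ ε : ℝ, 0 < ε ∧ ε < 1 ∧ ∀ s, 0 ≤ s → s ≤ 1 → s * β ≤ s₁ →
      (∃ B : ℝ, ∀ n, φ n ((1 - ε) * s) ≤ ENNReal.ofReal B) →
      ∃ B : ℝ, ∀ n, φ n s ≤ ENNReal.ofReal B := by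
  have hexp' : ∫⁻ ω, ENNReal.ofReal (Real.exp (C ω)) ∂P ≠ ⊤ := by
    rw [← ofReal_integral_eq_lintegral_ofReal hexp (Eventually.of_forall fun ω => (Real.exp_pos _).le)]
    exact ENNReal.ofReal_ne_top
  set E := ENNReal.ofReal (Real.exp (K * M)) with hE
  have hE0 : E ≠ 0 := by simp [hE, Real.exp_pos]
  have hEt : E ≠ ⊤ := ENNReal.ofReal_ne_top
  set ρ₀ := max (P {ω | T 0 ω = 1}) (∫⁻ ω in {ω | T 0 ω = 1}, ENNReal.ofReal (Real.exp (C ω)) ∂P)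
    with hρ₀
  have hρ₀1 : ρ₀ < 1 := max_lt h_one (by simpa [unitWeightMGF] using ha)
  -- This threshold keeps the event 1 - ε < T 0 < 1 below 1 - ρ₀ even after multiplication by the
  -- cost E of the other factors.
  have hδ : 0 < (1 - ρ₀) / E := ENNReal.div_pos (tsub_pos_of_lt hρ₀1).ne' hEt
  obtain ⟨ε, hε, hε', hA⟩ := exists_setLIntegral_near_one_lt P hCmeas (hT.measurable 0) hexp' hδ
  refine ⟨ε, hε, hε', fun s hs hs' hsβ ⟨B, hB⟩ => ?_⟩
  set e : Ω → ENNReal := fun ω => ENNReal.ofReal (Real.exp (s * C ω)) with he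
  have hem : Measurable e := by fun_prop
  set A₁ : Set Ω := {ω | T 0 ω = 1}
  set A₂ : Set Ω := {ω | 1 - ε < T 0 ω ∧ T 0 ω < 1}
  have hA₁ : MeasurableSet A₁ := measurableSet_eq_fun (hT.measurable 0) measurable_const
  have hA₂ : MeasurableSet A₂ := (measurableSet_lt measurable_const (hT.measurable 0)).inter
    (measurableSet_lt (hT.measurable 0) measurable_const)
  have h1 : ∫⁻ ω in A₁, e ω ∂P ≤ ρ₀ := setLIntegral_exp_mul_le_max P hCmeas hs hs' A₁
  have h2 : (∫⁻ ω in A₂, e ω ∂P) * E < 1 - ρ₀ := by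
    rw [← ENNReal.lt_div_iff_mul_lt (Or.inl hE0) (Or.inl hEt)]
    exact hA s hs hs'
  have h3 : ∫⁻ ω, e ω ∂P ≠ ⊤ := by
    have := setLIntegral_exp_mul_le_max P hCmeas hs hs' Set.univ
    rw [setLIntegral_univ, setLIntegral_univ] at this
    exact ne_top_of_le_ne_top (by simp [hexp']) this
  refine exists_bound_of_affine_recursion (x := fun n => φ n s)
    (ρ := ρ₀ + (∫⁻ ω in A₂, e ω ∂P) * E)
    (D := (∫⁻ ω, e ω ∂P) * (ENNReal.ofReal B * E)) ?_ ?_ (hφ.zero s).le ?_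
  · calc _ < ρ₀ + (1 - ρ₀) := ENNReal.add_lt_add_left hρ₀1.ne_top h2
      _ = 1 := add_tsub_cancel_of_le hρ₀1.le
  · exact ENNReal.mul_ne_top h3 (ENNReal.mul_ne_top ENNReal.ofReal_ne_top hEt)
  · intro n
    rw [hφ.succ]
    calc _ ≤ ∫⁻ ω, (A₁.indicator e ω * φ n s + A₂.indicator e ω * (φ n s * E) +
          e ω * (ENNReal.ofReal B * E)) ∂P := by
          refine lintegral_mono_ae ?_
          filter_upwards [hφ.ae_iSup_prod_le hT hK hs₁ (hb n) hs hs' hsβ, hT.nonneg, hT.le_one]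
            with ω hω h0 h1
          by_cases hω1 : T 0 ω = 1
          · have : ω ∈ A₁ := hω1
            rw [Set.indicator_of_mem this, add_assoc]
            exact le_add_right (by gcongr; exact hω.2 hω1)
          · by_cases hω2 : 1 - ε < T 0 ω
            · have : ω ∈ A₂ := ⟨hω2, lt_of_le_of_ne (h1 0) hω1⟩
              rw [Set.indicator_of_mem this]
              refine le_add_right (le_add_left ?_)
              gcongr
              refine hω.1.trans ?_
              gcongr
              rw [mul_comm]
              exact hφ.mono n s _ (h0 0) (h1 0)
            · refine le_add_left ?_
              gcongr
              refine hω.1.trans ?_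
              gcongr
              have h5 : s * T 0 ω = (T 0 ω / (1 - ε)) * ((1 - ε) * s) := by
                field_simp [(by linarith : 1 - ε ≠ 0)]
              rw [h5]
              refine (hφ.mono n _ _ (div_nonneg (h0 0) (by linarith)) ?_).trans (hB n)
              exact div_le_one_of_le₀ (by linarith) (by linarith)
      _ = (∫⁻ ω in A₁, e ω ∂P) * φ n s + (∫⁻ ω in A₂, e ω ∂P) * (φ n s * E) +
          (∫⁻ ω, e ω ∂P) * (ENNReal.ofReal B * E) := by
          rw [lintegral_add_right _ (hem.mul_const _),
            lintegral_add_right _ ((hem.indicator hA₂).mul_const _),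
            lintegral_mul_const _ (hem.indicator hA₁), lintegral_mul_const _ (hem.indicator hA₂),
            lintegral_mul_const _ hem, lintegral_indicator hA₁, lintegral_indicator hA₂]
      _ ≤ ρ₀ * φ n s + (∫⁻ ω in A₂, e ω ∂P) * (φ n s * E) +
          (∫⁻ ω, e ω ∂P) * (ENNReal.ofReal B * E) := by gcongr
      _ = _ := by ring

/-- If `E exp C` is finite and `E[exp C; T 0 = 1] < 1`, then the moment generating functions of
the iterates are bounded at `1`. -/
theorem exists_bound_one [IsProbabilityMeasure P] (hφ : IsMGFRecursion P C T φ) (hT : IsDampedWeight P T V M β)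
    (hβ : 0 < β) (hβ' : β < 1)
    (hCmeas : Measurable C) (hCm : ∫ ω, C ω ∂P = 0) (hC : MemLp C 2 P)
    (hexp : Integrable (fun ω => Real.exp (C ω)) P)
    (h_one : P {ω | T 0 ω = 1} < 1) (ha : unitWeightMGF P C T 1 < 1) :
    ∃ B : ℝ, ∀ n, φ n 1 ≤ ENNReal.ofReal B := by
  obtain ⟨K, hK, s₀, hs₀, hs₀', hsmall⟩ := hφ.exists_le_exp_sq hT hCm hC hexp
  have hbase : ∀ s, 0 ≤ s → s ≤ s₀ → ∃ B : ℝ, ∀ n, φ n s ≤ ENNReal.ofReal B := fun s hs hs' =>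
    hφ.exists_bound_mono hs hs' ⟨_, fun n => hsmall n s₀ hs₀.le le_rfl⟩
  -- A uniform bound at s₁ is turned back into the quadratic form needed for products: for u ≥ s₀
  -- the constant B is absorbed by |B| u² / s₀².
  have hquad : ∀ s₁, (∃ B : ℝ, ∀ n, φ n s₁ ≤ ENNReal.ofReal B) → ∃ K' : ℝ, 0 ≤ K' ∧
      ∀ n u, 0 ≤ u → u ≤ s₁ → φ n u ≤ ENNReal.ofReal (Real.exp (K' * u ^ 2)) := by
    rintro s₁ ⟨B, hB⟩
    refine ⟨K + |B| / s₀ ^ 2, by positivity, fun n u hu hu' => ?_⟩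
    rcases le_total u s₀ with h | h
    · refine (hsmall n u hu h).trans (ENNReal.ofReal_le_ofReal (Real.exp_le_exp.2 ?_))
      gcongr
      exact le_add_of_nonneg_right (by positivity)
    · have hu0 : 0 < u := hs₀.trans_le h
      have hs1 : 0 < s₁ := hu0.trans_le hu'
      have := hφ.mono n s₁ (u / s₁) (by positivity) (div_le_one_of_le₀ hu' hs1.le)
      rw [div_mul_cancel₀ _ hs1.ne'] at this
      refine this.trans ((hB n).trans (ENNReal.ofReal_le_ofReal ?_))
      have h1 : |B| ≤ (K + |B| / s₀ ^ 2) * u ^ 2 := by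
        have h2 : |B| / s₀ ^ 2 * s₀ ^ 2 = |B| := by field_simp
        have h3 : |B| / s₀ ^ 2 * s₀ ^ 2 ≤ |B| / s₀ ^ 2 * u ^ 2 := by gcongr
        nlinarith [mul_nonneg hK (sq_nonneg u)]
      linarith [le_abs_self B, Real.add_one_le_exp ((K + |B| / s₀ ^ 2) * u ^ 2)]
  -- Each increment of j enlarges the controlled range of s by the factor 1 / β.
  have hstep : ∀ j : ℕ, ∀ s, 0 ≤ s → s ≤ 1 → s * β ^ j ≤ s₀ →
      ∃ B : ℝ, ∀ n, φ n s ≤ ENNReal.ofReal B := by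
    intro j
    induction j with
    | zero => intro s hs _ h; exact hbase s hs (by simpa using h)
    | succ j ih =>
      intro s hs hs' h
      have hb1 := ih (s * β) (by positivity) (by nlinarith) (by rwa [mul_assoc, ← pow_succ'])
      obtain ⟨K', hK', hq⟩ := hquad _ hb1
      obtain ⟨ε, hε, hε', hext⟩ := hφ.exists_bound_extend hT hCmeas hexp h_one ha hK'
        (by positivity) hq
      obtain ⟨i, hi⟩ := exists_pow_lt_of_lt_one hβ (by linarith : 1 - ε < 1)
      have h1ε : 0 < 1 - ε := by linarith
      -- Since (1 - ε)^i < β, the point (1 - ε)^i s lies in the range already controlled; from there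
      -- one climbs back to s, one factor 1 - ε at a time.
      have hdown : ∀ l, l ≤ i → ∃ B : ℝ, ∀ n, φ n ((1 - ε) ^ l * s) ≤ ENNReal.ofReal B := by
        intro l hl
        induction hl using Nat.decreasingInduction with
        | self =>
          refine hφ.exists_bound_mono (by positivity) ?_ hb1
          rw [mul_comm]
          gcongr
        | of_succ l _ ihl =>
          have hl1 : (1 - ε) ^ l ≤ 1 := pow_le_one₀ h1ε.le (by linarith)
          have hls : (1 - ε) ^ l * s ≤ s := mul_le_of_le_one_left hs hl1
          refine hext _ (by positivity) (hls.trans hs') (by gcongr) ?_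
          rwa [← mul_assoc, ← pow_succ']
      simpa using hdown 0 (Nat.zero_le _)
  obtain ⟨j, hj⟩ := exists_pow_lt_of_lt_one hs₀ hβ'
  exact hstep j 1 zero_le_one le_rfl (by simpa using hj.le)

end IsMGFRecursion

/-! ### Marked trees and the law of the subtrees of the root -/

/-- The mark of a vertex: its innovation and the weights of the edges to its children. -/
abbrev Mark : Type := ℝ × (ℕ → ℝ)

/-- An assignment of marks to the vertices of the Ulam-Harris tree. -/
abbrev MarkedTree : Type := List ℕ → Mark

/-- The law of a tree with independent marks of law `μ`. -/
noncomputable abbrev treeLaw (μ : Measure Mark) : Measure MarkedTree :=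
  Measure.infinitePi fun _ : List ℕ => μ

/-- The subtree rooted at the `k`-th child of the root. -/
def subtree (k : ℕ) (x : MarkedTree) : MarkedTree := fun v => x (v ++ [k])

theorem measurable_subtree (k : ℕ) : Measurable (subtree k) := by
  unfold subtree; fun_prop

theorem snoc_injective : Function.Injective fun p : ℕ × List ℕ => p.2 ++ [p.1] := by
  rintro ⟨k, v⟩ ⟨l, w⟩ h
  have := List.append_inj' h rfl
  simp_all

/-- The root and the remaining vertices are disjoint sets of coordinates, hence independent. In the
reversed encoding the first step is the last list entry, so (k, v) ↦ v ++ [k] is injective and the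
remaining marks form a product over ℕ × List ℕ; currying makes this a product of tree laws. -/
theorem measurePreserving_root_subtree (μ : Measure Mark) [IsProbabilityMeasure μ] :
    MeasurePreserving (fun x : MarkedTree => (x [], fun k => subtree k x)) (treeLaw μ)
      (μ.prod (Measure.infinitePi fun _ : ℕ => treeLaw μ)) := by
  have hindep : IndepFun (fun x : MarkedTree => x [])
      (fun (x : MarkedTree) (p : ℕ × List ℕ) => x (p.2 ++ [p.1])) (treeLaw μ) := by
    have h0 : iIndepFun (fun (v : List ℕ) (x : MarkedTree) => x v) (treeLaw μ) :=
      iIndepFun_infinitePi (P := fun _ : List ℕ => μ) (X := fun _ y => y) fun _ => measurable_id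
    have h1 := indep_iSup_of_disjoint (fun v => (measurable_pi_apply v).comap_le)
      ((iIndepFun_iff_iIndep _ _ _).1 h0)
      (S := {[]}) (T := {v | v ≠ []}) (Set.disjoint_singleton_left.2 (by simp))
    rw [IndepFun_iff_Indep]
    refine indep_of_indep_of_le_left (indep_of_indep_of_le_right h1 ?_) ?_
    · rw [MeasurableSpace.pi, MeasurableSpace.comap_iSup]
      refine iSup_le fun p => ?_
      rw [MeasurableSpace.comap_comp]
      exact le_iSup₂_of_le (p.2 ++ [p.1]) (by simp) le_rfl
    · exact le_iSup₂_of_le [] rfl le_rfl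
  have hmap : (treeLaw μ).map (fun (x : MarkedTree) (p : ℕ × List ℕ) => x (p.2 ++ [p.1])) =
      Measure.infinitePi fun _ : ℕ × List ℕ => μ :=
    Measure.map_infinitePi_infinitePi_of_inj (P := fun _ : List ℕ => μ) snoc_injective
  have hroot : (treeLaw μ).map (fun x : MarkedTree => x []) = μ :=
    Measure.infinitePi_map_eval (fun _ : List ℕ => μ) []
  have hm1 : Measurable fun (x : MarkedTree) (p : ℕ × List ℕ) => x (p.2 ++ [p.1]) := by fun_prop
  have hm0 : Measurable fun x : MarkedTree => x [] := by fun_prop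
  have hjoint := (indepFun_iff_map_prod_eq_prod_map_map hm0.aemeasurable hm1.aemeasurable).1 hindep
  rw [hroot, hmap] at hjoint
  have hcurry := Measure.infinitePi_map_curry fun (_ : ℕ) (_ : List ℕ) => μ
  refine ⟨by unfold subtree; fun_prop, ?_⟩
  have hc : Measurable (MeasurableEquiv.curry ℕ (List ℕ) Mark) := (MeasurableEquiv.curry _ _ _).measurable
  calc _ = ((treeLaw μ).map fun x : MarkedTree =>
        (x [], fun p : ℕ × List ℕ => x (p.2 ++ [p.1]))).map
          (Prod.map id (MeasurableEquiv.curry ℕ (List ℕ) Mark)) := by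
        rw [Measure.map_map (measurable_id.prodMap hc) (hm0.prodMk hm1)]
        rfl
    _ = _ := by
        rw [hjoint, ← Measure.map_prod_map _ _ measurable_id hc, Measure.map_id, hcurry]

theorem measurePreserving_root_comp_subtree (μ : Measure Mark) [IsProbabilityMeasure μ]
    {f : MarkedTree → ℝ} (hf : Measurable f) :
    MeasurePreserving (fun x : MarkedTree => (x [], fun k => f (subtree k x))) (treeLaw μ)
      (μ.prod (Measure.infinitePi fun _ : ℕ => (treeLaw μ).map f)) := by
  have : IsProbabilityMeasure ((treeLaw μ).map f) := Measure.isProbabilityMeasure_map hf.aemeasurable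
  have h : MeasurePreserving (fun (z : ℕ → MarkedTree) k => f (z k))
      (Measure.infinitePi fun _ : ℕ => treeLaw μ)
      (Measure.infinitePi fun _ : ℕ => (treeLaw μ).map f) :=
    ⟨by fun_prop, Measure.infinitePi_map_pi _ fun _ => hf⟩
  exact ((MeasurePreserving.id μ).prod h).comp (measurePreserving_root_subtree μ)

theorem lintegral_root_comp_subtree (μ : Measure Mark) [IsProbabilityMeasure μ]
    {f : MarkedTree → ℝ} (hf : Measurable f) {F : Mark × (ℕ → ℝ) → ENNReal} (hF : Measurable F) :
    ∫⁻ x : MarkedTree, F (x [], fun k => f (subtree k x)) ∂treeLaw μ =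
      ∫⁻ e, ∫⁻ y, F (e, y) ∂(Measure.infinitePi fun _ : ℕ => (treeLaw μ).map f) ∂μ := by
  have : IsProbabilityMeasure ((treeLaw μ).map f) := Measure.isProbabilityMeasure_map hf.aemeasurable
  rw [← lintegral_prod _ hF.aemeasurable]
  exact (measurePreserving_root_comp_subtree μ hf).lintegral_comp hF

theorem measurePreserving_subtree (μ : Measure Mark) [IsProbabilityMeasure μ] (k : ℕ) :
    MeasurePreserving (subtree k) (treeLaw μ) (treeLaw μ) :=
  ⟨measurable_subtree k, Measure.map_infinitePi_infinitePi_of_inj (P := fun _ : List ℕ => μ)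
    (List.append_left_injective [k])⟩

/-! ### Weighted sums -/

/-- The sum `∑ k, t k * y k`, as the limit of its partial sums. -/
noncomputable def weightedSum (t y : ℕ → ℝ) : ℝ :=
  limUnder atTop fun N => ∑ k ∈ Finset.range N, t k * y k

theorem sum_range_eq_of_zero {t : ℕ → ℝ} {N n : ℕ} (ht : ∀ k, N ≤ k → t k = 0) (y : ℕ → ℝ)
    (hn : N ≤ n) : ∑ k ∈ Finset.range n, t k * y k = ∑ k ∈ Finset.range N, t k * y k :=
  (Finset.sum_subset (Finset.range_mono hn) fun k _ hk => by
    rw [ht k (by simpa using hk), zero_mul]).symm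

theorem weightedSum_eq {t : ℕ → ℝ} {N : ℕ} (ht : ∀ k, N ≤ k → t k = 0) (y : ℕ → ℝ) :
    weightedSum t y = ∑ k ∈ Finset.range N, t k * y k :=
  Tendsto.limUnder_eq (tendsto_atTop_of_eventually_const (i₀ := N) fun _ hn =>
    sum_range_eq_of_zero ht y hn)

theorem measurable_weightedSum {α : Type*} [MeasurableSpace α] {t y : α → ℕ → ℝ}
    (ht : ∀ k, Measurable fun a => t a k) (hy : ∀ k, Measurable fun a => y a k) :
    Measurable fun a => weightedSum (t a) (y a) :=
  (StronglyMeasurable.limUnder fun _ => (Finset.measurable_fun_sum _ fun k _ =>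
    (ht k).mul (hy k)).stronglyMeasurable).measurable

/-- The exponential moment `E exp (u * f)`. -/
noncomputable def expMoment {α : Type*} [MeasurableSpace α] (μ : Measure α) (f : α → ℝ) (u : ℝ) :
    ENNReal :=
  ∫⁻ x, ENNReal.ofReal (Real.exp (u * f x)) ∂μ

/-- Integrate 1 + u f ≤ exp (u f). Passing through the positive part of 1 + u f allows the
exponential moment to be infinite. -/
theorem one_le_expMoment {α : Type*} [MeasurableSpace α] {μ : Measure α} [IsProbabilityMeasure μ]
    {f : α → ℝ} (hf : Integrable f μ) (hm : ∫ x, f x ∂μ = 0) (u : ℝ) : 1 ≤ expMoment μ f u := by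
  have h1 : ∫ x, (1 + u * f x) ∂μ = 1 := by
    rw [integral_add (integrable_const 1) (hf.const_mul u), integral_const_mul, hm]
    simp
  calc (1 : ENNReal) = ENNReal.ofReal (∫ x, (1 + u * f x) ∂μ) := by simp [h1]
    _ ≤ ∫⁻ x, ENNReal.ofReal (1 + u * f x) ∂μ := by
        have hi : Integrable (fun x => 1 + u * f x) μ := (integrable_const 1).add (hf.const_mul u)
        rw [integral_eq_lintegral_pos_part_sub_lintegral_neg_part hi]
        refine (ENNReal.ofReal_le_ofReal (sub_le_self _ ENNReal.toReal_nonneg)).trans ?_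
        exact ENNReal.ofReal_toReal_le
    _ ≤ _ := lintegral_mono fun x => ENNReal.ofReal_le_ofReal (by
        rw [add_comm]; exact Real.add_one_le_exp _)

/-- By convexity the value at t * u is at most the larger of the values at 0 and u, and the value at
0 is 1. -/
theorem expMoment_mul_le {α : Type*} [MeasurableSpace α] {μ : Measure α} [IsProbabilityMeasure μ]
    {f : α → ℝ} (hf : Measurable f) {u t : ℝ} (h1 : 1 ≤ expMoment μ f u) (ht : 0 ≤ t)
    (ht' : t ≤ 1) : expMoment μ f (t * u) ≤ expMoment μ f u := by
  have := setLIntegral_exp_mul_le_max μ (C := fun x => u * f x) (by fun_prop) ht ht' Set.univ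
  simp only [setLIntegral_univ, measure_univ, ← mul_assoc] at this
  exact this.trans (max_le h1 le_rfl)

theorem lintegral_exp_sum_infinitePi (ν : Measure ℝ) [IsProbabilityMeasure ν] (t : ℕ → ℝ) (u : ℝ)
    (N : ℕ) :
    ∫⁻ y, ENNReal.ofReal (Real.exp (u * ∑ k ∈ Finset.range N, t k * y k))
        ∂(Measure.infinitePi fun _ : ℕ => ν) =
      ∏ k ∈ Finset.range N, expMoment ν id (u * t k) := by
  have h := lintegral_prod_eq_prod_lintegral_of_indepFun (Finset.range N)
    (fun k (y : ℕ → ℝ) => ENNReal.ofReal (Real.exp (u * t k * y k)))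
    (iIndepFun_infinitePi (P := fun _ : ℕ => ν)
      (X := fun k y => ENNReal.ofReal (Real.exp (u * t k * y))) fun k => by fun_prop)
    fun k => by fun_prop
  calc _ = ∫⁻ y, ∏ k ∈ Finset.range N, ENNReal.ofReal (Real.exp (u * t k * y k))
        ∂(Measure.infinitePi fun _ : ℕ => ν) := by
        refine lintegral_congr fun y => ?_
        rw [← ENNReal.ofReal_prod_of_nonneg fun _ _ => (Real.exp_pos _).le, ← Real.exp_sum,
          Finset.mul_sum]
        simp_rw [mul_assoc]
    _ = _ := by
        rw [h]
        refine Finset.prod_congr rfl fun k _ => ?_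
        exact (measurePreserving_eval_infinitePi (fun _ : ℕ => ν) k).lintegral_comp
          (f := fun y : ℝ => ENNReal.ofReal (Real.exp (u * t k * y))) (by fun_prop)

/-- Factors at least 1 make the partial products increase, and factors equal to 1 beyond N make them
stabilise. Thus the recursion can be written without mentioning the random number of weights. -/
theorem iSup_prod_range_eq {ψ : ℝ → ENNReal} (hψ : ∀ u, 1 ≤ ψ u) (hψ0 : ψ 0 = 1) {t : ℕ → ℝ}
    {N : ℕ} (ht : ∀ k, N ≤ k → t k = 0) (u : ℝ) :
    ⨆ n, ∏ k ∈ Finset.range n, ψ (u * t k) = ∏ k ∈ Finset.range N, ψ (u * t k) := by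
  refine le_antisymm (iSup_le fun n => ?_) (le_iSup (fun n => ∏ k ∈ Finset.range n, ψ (u * t k)) N)
  rcases le_total n N with h | h
  · exact Finset.prod_le_prod_of_subset_of_one_le' (Finset.range_mono h) fun k _ _ => hψ _
  · refine (Finset.prod_subset (Finset.range_mono h) fun k _ hk => ?_).ge
    rw [ht k (by simpa using hk), mul_zero, hψ0]

theorem expMoment_zero {α : Type*} [MeasurableSpace α] (μ : Measure α) [IsProbabilityMeasure μ]
    (f : α → ℝ) : expMoment μ f 0 = 1 := by
  simp [expMoment]

theorem expMoment_map {α : Type*} [MeasurableSpace α] (μ : Measure α) {f : α → ℝ}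
    (hf : Measurable f) (u : ℝ) : expMoment (μ.map f) id u = expMoment μ f u :=
  lintegral_map (f := fun y : ℝ => ENNReal.ofReal (Real.exp (u * y))) (by fun_prop) hf

/-- The exponential moments of `x ↦ C + ∑ k, T k * f (subtree k x)`. -/
theorem expMoment_smoothing (μ : Measure Mark) [IsProbabilityMeasure μ]
    (hfin : ∀ᵐ e ∂μ, ∃ N, ∀ k, N ≤ k → e.2 k = 0)
    {f g : MarkedTree → ℝ} (hf : Measurable f)
    (hf1 : ∀ u, 1 ≤ expMoment (treeLaw μ) f u)
    (hg : ∀ᵐ x ∂treeLaw μ, g x = (x []).1 + weightedSum (x []).2 fun k => f (subtree k x))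
    (u : ℝ) :
    expMoment (treeLaw μ) g u = ∫⁻ e, ENNReal.ofReal (Real.exp (u * e.1)) *
      ⨆ N, ∏ k ∈ Finset.range N, expMoment (treeLaw μ) f (u * e.2 k) ∂μ := by
  have : IsProbabilityMeasure ((treeLaw μ).map f) := Measure.isProbabilityMeasure_map hf.aemeasurable
  let F : Mark × (ℕ → ℝ) → ENNReal := fun p =>
    ENNReal.ofReal (Real.exp (u * (p.1.1 + weightedSum p.1.2 p.2)))
  have hmeas : Measurable F := by
    have : Measurable fun p : Mark × (ℕ → ℝ) => weightedSum p.1.2 p.2 :=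
      measurable_weightedSum (fun k => by fun_prop) fun k => by fun_prop
    fun_prop
  have h1 : expMoment (treeLaw μ) g u =
      ∫⁻ x : MarkedTree, F (x [], fun k => f (subtree k x)) ∂treeLaw μ :=
    lintegral_congr_ae (hg.mono fun x hx => by simp only [hx, F])
  rw [h1, lintegral_root_comp_subtree μ hf hmeas]
  refine lintegral_congr_ae ?_
  filter_upwards [hfin] with e ⟨N, hN⟩
  simp only [F, weightedSum_eq hN, mul_add, Real.exp_add, ENNReal.ofReal_mul (Real.exp_pos _).le]
  rw [lintegral_const_mul _ (by fun_prop), lintegral_exp_sum_infinitePi,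
    iSup_prod_range_eq hf1 (expMoment_zero _ f) hN]
  simp_rw [expMoment_map _ hf]

/-! ### Second moments and convergence of the iterates -/

theorem moments_sum_infinitePi (ν : Measure ℝ) [IsProbabilityMeasure ν] (hν : MemLp id 2 ν)
    (hm : ∫ y, y ∂ν = 0) (t : ℕ → ℝ) (N : ℕ) :
    ∫ y, ∑ k ∈ Finset.range N, t k * y k ∂(Measure.infinitePi fun _ : ℕ => ν) = 0 ∧
    ∫⁻ y, ENNReal.ofReal ((∑ k ∈ Finset.range N, t k * y k) ^ 2)
        ∂(Measure.infinitePi fun _ : ℕ => ν) =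
      ENNReal.ofReal (∑ k ∈ Finset.range N, t k ^ 2) * ∫⁻ y, ENNReal.ofReal (y ^ 2) ∂ν := by
  set π := Measure.infinitePi fun _ : ℕ => ν
  have hev : ∀ k, MeasurePreserving (fun y : ℕ → ℝ => y k) π ν := fun k =>
    measurePreserving_eval_infinitePi (fun _ : ℕ => ν) k
  have hL : ∀ k, MemLp (fun y : ℕ → ℝ => t k * y k) 2 π := fun k =>
    (hν.comp_measurePreserving (hev k)).const_mul (t k)
  have hmean : ∀ k, ∫ y, t k * y k ∂π = 0 := fun k => by
    have : ∫ y : ℕ → ℝ, y k ∂π = ∫ y, y ∂ν := by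
      rw [← (hev k).map_eq, integral_map (hev k).measurable.aemeasurable (by fun_prop)]
    rw [integral_const_mul, this, hm, mul_zero]
  have hvar : ∀ k, Var[fun y : ℕ → ℝ => t k * y k; π] = t k ^ 2 * ∫ y, y ^ 2 ∂ν := fun k => by
    rw [variance_of_integral_eq_zero (hL k).aemeasurable (hmean k)]
    have : ∫ y : ℕ → ℝ, y k ^ 2 ∂π = ∫ y, y ^ 2 ∂ν := by
      rw [← (hev k).map_eq, integral_map (hev k).measurable.aemeasurable (by fun_prop)]
    simp_rw [mul_pow, integral_const_mul, this]
  have hsum0 : ∫ y, ∑ k ∈ Finset.range N, t k * y k ∂π = 0 := by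
    rw [integral_finsetSum _ fun k _ => (hL k).integrable one_le_two]
    exact Finset.sum_eq_zero fun k _ => hmean k
  refine ⟨hsum0, ?_⟩
  have hindep : iIndepFun (fun k (y : ℕ → ℝ) => t k * y k) π :=
    iIndepFun_infinitePi (P := fun _ : ℕ => ν) (X := fun k y => t k * y) fun k => by fun_prop
  have hsL : MemLp (fun y : ℕ → ℝ => ∑ k ∈ Finset.range N, t k * y k) 2 π :=
    memLp_finsetSum _ fun k _ => hL k
  have hv := IndepFun.variance_sum (μ := π) (s := Finset.range N)
    (X := fun k (y : ℕ → ℝ) => t k * y k) (fun k _ => hL k)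
    fun i _ j _ hij => hindep.indepFun hij
  have he : (∑ k ∈ Finset.range N, fun y : ℕ → ℝ => t k * y k) =
      fun y => ∑ k ∈ Finset.range N, t k * y k := by ext y; simp
  rw [he, variance_of_integral_eq_zero hsL.aemeasurable hsum0] at hv
  have hν2 : Integrable (fun y => y ^ 2) ν := hν.integrable_sq
  rw [← ofReal_integral_eq_lintegral_ofReal hsL.integrable_sq
      (Eventually.of_forall fun _ => sq_nonneg _),
    ← ofReal_integral_eq_lintegral_ofReal hν2
      (Eventually.of_forall fun _ => sq_nonneg _), hv,
    ← ENNReal.ofReal_mul (Finset.sum_nonneg fun _ _ => sq_nonneg _), Finset.sum_mul]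
  simp_rw [hvar]

/-- Given the root mark, the subtree values are i.i.d. and centred, so cross terms vanish. Each
generation therefore multiplies the second moment by the same factor. -/
theorem lintegral_sq_smoothing (μ : Measure Mark) [IsProbabilityMeasure μ]
    (hfin : ∀ᵐ e ∂μ, ∃ N, ∀ k, N ≤ k → e.2 k = 0)
    {f : MarkedTree → ℝ} (hf : Measurable f) (hf2 : MemLp f 2 (treeLaw μ))
    (hf0 : ∫ x, f x ∂treeLaw μ = 0) :
    ∫⁻ x : MarkedTree, ENNReal.ofReal ((weightedSum (x []).2 fun k => f (subtree k x)) ^ 2)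
        ∂treeLaw μ =
      (∫⁻ e, ∑' k, ENNReal.ofReal (e.2 k ^ 2) ∂μ) *
        ∫⁻ x, ENNReal.ofReal (f x ^ 2) ∂treeLaw μ := by
  have : IsProbabilityMeasure ((treeLaw μ).map f) := Measure.isProbabilityMeasure_map hf.aemeasurable
  have hν : MemLp id 2 ((treeLaw μ).map f) :=
    (memLp_map_measure_iff aestronglyMeasurable_id hf.aemeasurable).2 hf2
  have hm : ∫ y, y ∂((treeLaw μ).map f) = 0 := by
    rw [integral_map hf.aemeasurable (by fun_prop), hf0]
  let F : Mark × (ℕ → ℝ) → ENNReal := fun p => ENNReal.ofReal (weightedSum p.1.2 p.2 ^ 2)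
  have hF : Measurable F := by
    have : Measurable fun p : Mark × (ℕ → ℝ) => weightedSum p.1.2 p.2 :=
      measurable_weightedSum (fun k => by fun_prop) fun k => by fun_prop
    fun_prop
  refine (lintegral_root_comp_subtree μ hf hF).trans ?_
  rw [← lintegral_mul_const _ (Measurable.tsum fun k => by fun_prop)]
  refine lintegral_congr_ae ?_
  filter_upwards [hfin] with e ⟨N, hN⟩
  simp only [F, weightedSum_eq hN]
  rw [(moments_sum_infinitePi _ hν hm e.2 N).2, lintegral_map (by fun_prop) hf,
    tsum_eq_sum (s := Finset.range N) fun k hk => by rw [hN k (by simpa using hk)]; simp,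
    ENNReal.ofReal_sum_of_nonneg fun _ _ => sq_nonneg _]

theorem integral_smoothing_eq_zero (μ : Measure Mark) [IsProbabilityMeasure μ]
    (hfin : ∀ᵐ e ∂μ, ∃ N, ∀ k, N ≤ k → e.2 k = 0)
    {f : MarkedTree → ℝ} (hf : Measurable f) (hf2 : MemLp f 2 (treeLaw μ))
    (hf0 : ∫ x, f x ∂treeLaw μ = 0)
    (hi : Integrable (fun x : MarkedTree => weightedSum (x []).2 fun k => f (subtree k x))
      (treeLaw μ)) :
    ∫ x : MarkedTree, weightedSum (x []).2 (fun k => f (subtree k x)) ∂treeLaw μ = 0 := by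
  have : IsProbabilityMeasure ((treeLaw μ).map f) := Measure.isProbabilityMeasure_map hf.aemeasurable
  have hν : MemLp id 2 ((treeLaw μ).map f) :=
    (memLp_map_measure_iff aestronglyMeasurable_id hf.aemeasurable).2 hf2
  have hm : ∫ y, y ∂((treeLaw μ).map f) = 0 := by
    rw [integral_map hf.aemeasurable (by fun_prop), hf0]
  let F : Mark × (ℕ → ℝ) → ℝ := fun p => weightedSum p.1.2 p.2
  have hF : Measurable F := measurable_weightedSum (fun k => by fun_prop) fun k => by fun_prop
  have hmp := measurePreserving_root_comp_subtree μ hf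
  have hFi : Integrable F (μ.prod (Measure.infinitePi fun _ : ℕ => (treeLaw μ).map f)) :=
    (hmp.integrable_comp hF.aestronglyMeasurable).1 hi
  have h1 := integral_map hmp.measurable.aemeasurable
    (hF.aestronglyMeasurable (μ := (treeLaw μ).map _))
  rw [hmp.map_eq] at h1
  refine h1.symm.trans ?_
  rw [integral_prod _ hFi]
  refine integral_eq_zero_of_ae ?_
  filter_upwards [hfin] with e ⟨N, hN⟩
  simp only [F, weightedSum_eq hN]
  exact (moments_sum_infinitePi _ hν hm e.2 N).1

/-- The contribution of the `n`-th generation of a marked tree. -/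
noncomputable def generation : ℕ → MarkedTree → ℝ
  | 0, x => (x []).1
  | n + 1, x => weightedSum (x []).2 fun k => generation n (subtree k x)

theorem measurable_generation (n : ℕ) : Measurable (generation n) := by
  induction n with
  | zero => exact (measurable_pi_apply []).fst
  | succ n ih =>
    have := measurable_subtree
    exact measurable_weightedSum (fun k => by fun_prop) fun k => ih.comp (this k)

/-- Square-integrable centred innovations and finitely many nonzero weights whose squares have an
expected sum less than `1`. -/
structure IsSubcritical (μ : Measure Mark) : Prop where
  finite : ∀ᵐ e ∂μ, ∃ N, ∀ k, N ≤ k → e.2 k = 0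
  memLp : MemLp (fun e : Mark => e.1) 2 μ
  mean : ∫ e, e.1 ∂μ = 0
  lintegral_lt : ∫⁻ e, ∑' k, ENNReal.ofReal (e.2 k ^ 2) ∂μ < 1

theorem memLp_two_of_lintegral_sq {α : Type*} [MeasurableSpace α] {μ : Measure α} {f : α → ℝ}
    (hf : AEStronglyMeasurable f μ) (h : ∫⁻ x, ENNReal.ofReal (f x ^ 2) ∂μ ≠ ⊤) : MemLp f 2 μ := by
  rw [memLp_two_iff_integrable_sq hf]
  exact (lintegral_ofReal_ne_top_iff_integrable (hf.pow 2)
    (Eventually.of_forall fun _ => sq_nonneg _)).1 h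

/-- The iterates of the smoothing transform, started at `0`. -/
noncomputable def iterate (n : ℕ) (x : MarkedTree) : ℝ :=
  ∑ k ∈ Finset.range n, generation k x

/-- The limit of the iterates of the smoothing transform. -/
noncomputable def limitSolution (x : MarkedTree) : ℝ :=
  limUnder atTop fun n => iterate n x

theorem measurable_iterate (n : ℕ) : Measurable (iterate n) :=
  Finset.measurable_fun_sum _ fun k _ => measurable_generation k

theorem measurable_limitSolution : Measurable limitSolution :=
  (StronglyMeasurable.limUnder fun n => (measurable_iterate n).stronglyMeasurable).measurable

theorem iterate_succ_eq {x : MarkedTree} (hx : ∃ N, ∀ k, N ≤ k → (x []).2 k = 0) (n : ℕ) :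
    iterate (n + 1) x = (x []).1 + weightedSum (x []).2 fun k => iterate n (subtree k x) := by
  obtain ⟨N, hN⟩ := hx
  rw [iterate, Finset.sum_range_succ', add_comm]
  simp only [generation, weightedSum_eq hN, iterate, Finset.mul_sum]
  rw [Finset.sum_comm]

namespace IsSubcritical

variable {μ : Measure Mark} [IsProbabilityMeasure μ]

theorem ae_root_finite (h : IsSubcritical μ) :
    ∀ᵐ x ∂treeLaw μ, ∃ N, ∀ k, N ≤ k → (x []).2 k = 0 :=
  (measurePreserving_eval_infinitePi (fun _ : List ℕ => μ) []).quasiMeasurePreserving.ae h.finite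

theorem generation_moments (h : IsSubcritical μ) (n : ℕ) :
    MemLp (generation n) 2 (treeLaw μ) ∧ ∫ x, generation n x ∂treeLaw μ = 0 ∧
      ∫⁻ x, ENNReal.ofReal (generation n x ^ 2) ∂treeLaw μ =
        (∫⁻ e, ∑' k, ENNReal.ofReal (e.2 k ^ 2) ∂μ) ^ n * ∫⁻ e, ENNReal.ofReal (e.1 ^ 2) ∂μ := by
  induction n with
  | zero =>
    have hev : MeasurePreserving (fun x : MarkedTree => x []) (treeLaw μ) μ :=
      measurePreserving_eval_infinitePi (fun _ : List ℕ => μ) []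
    refine ⟨h.memLp.comp_measurePreserving hev, ?_, ?_⟩
    · have h1 := integral_map (μ := treeLaw μ) hev.measurable.aemeasurable (f := fun e : Mark => e.1)
        (by fun_prop)
      rw [hev.map_eq, h.mean] at h1
      exact h1.symm
    · rw [pow_zero, one_mul]
      exact hev.lintegral_comp (f := fun e : Mark => ENNReal.ofReal (e.1 ^ 2)) (by fun_prop)
  | succ n ih =>
    obtain ⟨ih1, ih2, ih3⟩ := ih
    have h3 : ∫⁻ x, ENNReal.ofReal (generation (n + 1) x ^ 2) ∂treeLaw μ = _ :=
      lintegral_sq_smoothing μ h.finite (measurable_generation n) ih1 ih2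
    rw [ih3, ← mul_assoc, ← pow_succ'] at h3
    have h1 : MemLp (generation (n + 1)) 2 (treeLaw μ) := by
      refine memLp_two_of_lintegral_sq (measurable_generation _).aestronglyMeasurable ?_
      rw [h3, ← ofReal_integral_eq_lintegral_ofReal h.memLp.integrable_sq
        (Eventually.of_forall fun _ => sq_nonneg _)]
      exact ENNReal.mul_ne_top (ENNReal.pow_ne_top h.lintegral_lt.ne_top) ENNReal.ofReal_ne_top
    exact ⟨h1, integral_smoothing_eq_zero μ h.finite (measurable_generation n) ih1 ih2
      (h1.integrable one_le_two), h3⟩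

theorem integrable_iterate (h : IsSubcritical μ) (n : ℕ) : Integrable (iterate n) (treeLaw μ) :=
  integrable_finsetSum _ fun k _ => (h.generation_moments k).1.integrable one_le_two

theorem integral_iterate (h : IsSubcritical μ) (n : ℕ) : ∫ x, iterate n x ∂treeLaw μ = 0 := by
  simp only [iterate]
  rw [integral_finsetSum _ fun k _ => (h.generation_moments k).1.integrable one_le_two]
  exact Finset.sum_eq_zero fun k _ => (h.generation_moments k).2.1

/-- On a probability space the L¹ norm is at most the L² norm, here q^(n/2) σ^(1/2) with q < 1: a
geometric series. -/
theorem tsum_lintegral_generation_ne_top (h : IsSubcritical μ) :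
    ∑' n, ∫⁻ x, ‖generation n x‖ₑ ∂treeLaw μ ≠ ⊤ := by
  set q := ∫⁻ e, ∑' k, ENNReal.ofReal (e.2 k ^ 2) ∂μ with hq
  set σ := ∫⁻ e, ENNReal.ofReal (e.1 ^ 2) ∂μ with hσ
  have hσt : σ ≠ ⊤ := by
    rw [hσ, ← ofReal_integral_eq_lintegral_ofReal h.memLp.integrable_sq
      (Eventually.of_forall fun _ => sq_nonneg _)]
    exact ENNReal.ofReal_ne_top
  have hle : ∀ n, ∫⁻ x, ‖generation n x‖ₑ ∂treeLaw μ ≤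
      (q ^ (1 / 2 : ℝ)) ^ n * σ ^ (1 / 2 : ℝ) := by
    intro n
    rw [← eLpNorm_one_eq_lintegral_enorm]
    refine (eLpNorm_le_eLpNorm_of_exponent_le one_le_two
      (measurable_generation n).aestronglyMeasurable).trans (le_of_eq ?_)
    rw [eLpNorm_eq_lintegral_rpow_enorm_toReal two_ne_zero ENNReal.ofNat_ne_top]
    have : ∀ x, ‖generation n x‖ₑ ^ (2 : ENNReal).toReal =
        ENNReal.ofReal (generation n x ^ 2) := fun x => by
      rw [ENNReal.toReal_ofNat, ← sq_abs, ENNReal.ofReal_pow (abs_nonneg _), ← Real.enorm_eq_ofReal_abs]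
      exact_mod_cast ENNReal.rpow_natCast _ 2
    simp_rw [this]
    rw [(h.generation_moments n).2.2, ENNReal.mul_rpow_of_nonneg _ _ (by norm_num),
      ENNReal.toReal_ofNat, ← ENNReal.rpow_natCast, ← ENNReal.rpow_natCast, ← ENNReal.rpow_mul,
      ← ENNReal.rpow_mul, mul_comm (n : ℝ)]
  refine ne_top_of_le_ne_top ?_ (ENNReal.tsum_le_tsum hle)
  rw [ENNReal.tsum_mul_right, ENNReal.tsum_geometric]
  refine ENNReal.mul_ne_top (ENNReal.inv_ne_top.2 ?_) (ENNReal.rpow_ne_top_of_nonneg (by norm_num) hσt)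
  exact (tsub_pos_of_lt (ENNReal.rpow_lt_one h.lintegral_lt (by norm_num))).ne'

theorem ae_tsum_enorm_lt_top (h : IsSubcritical μ) :
    ∀ᵐ x ∂treeLaw μ, ∑' n, ‖generation n x‖ₑ < ⊤ := by
  have hm : ∀ n, Measurable fun x => ‖generation n x‖ₑ := fun n => (measurable_generation n).enorm
  refine ae_lt_top (Measurable.tsum hm) ?_
  rw [lintegral_tsum fun n => (hm n).aemeasurable]
  exact h.tsum_lintegral_generation_ne_top

theorem ae_hasSum (h : IsSubcritical μ) :
    ∀ᵐ x ∂treeLaw μ, HasSum (fun n => generation n x) (limitSolution x) := by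
  filter_upwards [h.ae_tsum_enorm_lt_top] with x hx
  have hs : Summable fun n => generation n x :=
    (tsum_enorm_ne_top_iff_summable_norm.1 hx.ne).of_norm
  have : limitSolution x = ∑' n, generation n x := hs.hasSum.tendsto_sum_nat.limUnder_eq
  rw [this]
  exact hs.hasSum

theorem ae_tendsto (h : IsSubcritical μ) :
    ∀ᵐ x ∂treeLaw μ, Tendsto (fun n => iterate n x) atTop (𝓝 (limitSolution x)) :=
  h.ae_hasSum.mono fun _ hx => hx.tendsto_sum_nat

theorem integrable_limitSolution (h : IsSubcritical μ) :
    Integrable limitSolution (treeLaw μ) := by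
  refine ⟨measurable_limitSolution.aestronglyMeasurable, ?_⟩
  refine lt_of_le_of_lt (lintegral_mono_ae (g := fun x => ∑' n, ‖generation n x‖ₑ) ?_) ?_
  · filter_upwards [h.ae_hasSum] with x hx
    rw [← hx.tsum_eq]
    exact enorm_tsum_le_tsum_enorm
  · rw [lintegral_tsum fun n => (measurable_generation n).enorm.aemeasurable]
    exact h.tsum_lintegral_generation_ne_top.lt_top

theorem integral_limitSolution (h : IsSubcritical μ) : ∫ x, limitSolution x ∂treeLaw μ = 0 := by
  rw [integral_congr_ae (h.ae_hasSum.mono fun x hx => hx.tsum_eq.symm),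
    integral_tsum (fun n => (measurable_generation n).aestronglyMeasurable)
      h.tsum_lintegral_generation_ne_top]
  simp [fun n => (h.generation_moments n).2.1]

/-- Each subtree again has the tree law, so the iterates converge almost surely in all countably
many subtrees at once; the weighted sum is finite, so the limit passes through it. -/
theorem limitSolution_fixedPoint (h : IsSubcritical μ) :
    ∀ᵐ x ∂treeLaw μ, limitSolution x =
      (x []).1 + weightedSum (x []).2 fun k => limitSolution (subtree k x) := by
  have hsub : ∀ᵐ x ∂treeLaw μ, ∀ k, Tendsto (fun n => iterate n (subtree k x)) atTop
      (𝓝 (limitSolution (subtree k x))) :=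
    ae_all_iff.2 fun k => (measurePreserving_subtree μ k).quasiMeasurePreserving.ae h.ae_tendsto
  filter_upwards [h.ae_tendsto, hsub, h.ae_root_finite] with x hx hxs hfin
  have h1 := hx.comp (tendsto_add_atTop_nat 1)
  have h2 : Tendsto (fun n => iterate (n + 1) x) atTop
      (𝓝 ((x []).1 + weightedSum (x []).2 fun k => limitSolution (subtree k x))) := by
    simp_rw [iterate_succ_eq hfin]
    obtain ⟨N, hN⟩ := hfin
    simp_rw [weightedSum_eq hN]
    exact (tendsto_finsetSum _ fun k _ => (hxs k).const_mul _).const_add _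
  exact tendsto_nhds_unique h1 h2

end IsSubcritical

/-! ### The iterates in terms of the weighted branching model -/

/-- The definition peels off the edge farthest from the root, whereas induction over subtrees needs
the first edge. -/
theorem branchWeight_snoc {Ω : Type*} (TT : List ℕ → ℕ → Ω → ℝ) (k : ℕ) (v : List ℕ) (ω : Ω) :
    branchWeight TT (v ++ [k]) ω = TT [] k ω * branchWeight (fun w => TT (w ++ [k])) v ω := by
  induction v with
  | nil => simp [branchWeight]
  | cons j v ih => simp only [List.cons_append, branchWeight, ih]; ring

/-- Prepending a first generation step to the vertices of generation `n`. -/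
noncomputable def snocEquiv (n : ℕ) :
    ℕ × {v : List ℕ // v.length = n} ≃ {v : List ℕ // v.length = n + 1} :=
  Equiv.ofBijective (fun p => ⟨p.2.1 ++ [p.1], by simp [p.2.2]⟩) <| by
    constructor
    · rintro ⟨k, v, hv⟩ ⟨l, w, hw⟩ h
      have := snoc_injective (a₁ := (k, v)) (a₂ := (l, w)) (congrArg Subtype.val h)
      simp_all
    · rintro ⟨v, hv⟩
      have hne : v ≠ [] := by rintro rfl; simp at hv
      exact ⟨(v.getLast hne, ⟨v.dropLast, by simp [hv]⟩),
        Subtype.ext (List.dropLast_append_getLast hne)⟩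

theorem finite_branchWeight_ne_zero {Ω : Type*} {ω : Ω} (n : ℕ) (TT : List ℕ → ℕ → Ω → ℝ)
    (h : ∀ v, ∃ N, ∀ k, N ≤ k → TT v k ω = 0) :
    {v : {v : List ℕ // v.length = n} | branchWeight TT v.1 ω ≠ 0}.Finite := by
  induction n generalizing TT with
  | zero =>
    have : Finite {v : List ℕ // v.length = 0} :=
      Finite.of_injective (fun _ => ()) fun a b _ => Subtype.ext
        ((List.length_eq_zero_iff.1 a.2).trans (List.length_eq_zero_iff.1 b.2).symm)
    exact Set.toFinite _
  | succ n ih =>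
    obtain ⟨N, hN⟩ := h []
    refine ((Set.finite_lt_nat N).biUnion fun k _ =>
      (ih (fun w => TT (w ++ [k])) fun v => h _).image fun v => snocEquiv n (k, v)).subset ?_
    intro v hv
    obtain ⟨⟨k, w⟩, rfl⟩ := (snocEquiv n).surjective v
    have hv' : branchWeight TT (w.1 ++ [k]) ω ≠ 0 := hv
    rw [branchWeight_snoc] at hv'
    refine Set.mem_biUnion (x := k) ?_ ⟨w, right_ne_zero_of_mul hv', rfl⟩
    by_contra hk
    exact left_ne_zero_of_mul hv' (hN k (not_lt.1 hk))

/-- Finite support gives summability, so the sum over generation n + 1 may be grouped by the first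
step; the induction varies the model because each group is the same sum in a subtree. -/
theorem generationSum_eq {Ω : Type*} {ω : Ω} (n : ℕ) (CC : List ℕ → Ω → ℝ)
    (TT : List ℕ → ℕ → Ω → ℝ) (h : ∀ v, ∃ N, ∀ k, N ≤ k → TT v k ω = 0) :
    generationSum CC TT n ω = generation n fun v => (CC v ω, fun k => TT v k ω) := by
  induction n generalizing CC TT with
  | zero =>
    rw [generationSum, tsum_eq_single ⟨[], rfl⟩]
    · simp [branchWeight, generation]
    · rintro ⟨v, hv⟩ hne
      exact absurd (Subtype.ext (List.length_eq_zero_iff.1 hv)) hne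
  | succ n ih =>
    obtain ⟨N, hN⟩ := h []
    have hs : Summable fun v : {v : List ℕ // v.length = n + 1} =>
        branchWeight TT v.1 ω * CC v.1 ω :=
      summable_of_hasFiniteSupport <| (finite_branchWeight_ne_zero (n + 1) TT h).subset
        fun v hv => left_ne_zero_of_mul hv
    rw [generationSum, ← (snocEquiv n).tsum_eq]
    have hs' := (snocEquiv n).summable_iff.2 hs
    refine (Summable.tsum_prod hs').trans ?_
    have hk : ∀ k, ∑' v : {v : List ℕ // v.length = n},
        branchWeight TT (snocEquiv n (k, v)).1 ω * CC (snocEquiv n (k, v)).1 ω =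
        TT [] k ω * generation n (subtree k fun v => (CC v ω, fun k => TT v k ω)) := by
      intro k
      have h1 := ih (fun w => CC (w ++ [k])) (fun w => TT (w ++ [k])) fun v => h _
      rw [generationSum] at h1
      calc _ = ∑' v : {v : List ℕ // v.length = n}, TT [] k ω *
            (branchWeight (fun w => TT (w ++ [k])) v.1 ω * CC (v.1 ++ [k]) ω) := by
            refine tsum_congr fun v => ?_
            change branchWeight TT (v.1 ++ [k]) ω * CC (v.1 ++ [k]) ω = _
            rw [branchWeight_snoc, mul_assoc]
        _ = _ := by rw [tsum_mul_left, h1]; rfl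
    refine (tsum_congr hk).trans ?_
    rw [generation, weightedSum_eq (t := fun k => TT [] k ω) hN]
    exact tsum_eq_sum fun k hk => by rw [hN k (by simpa using hk), zero_mul]

/-! ### Exponential moments of the iterates and of their limit -/

theorem measurable_expMoment {α : Type*} [MeasurableSpace α] (μ : Measure α) [SFinite μ]
    {f : α → ℝ} (hf : Measurable f) : Measurable (expMoment μ f) :=
  Measurable.lintegral_prod_right' (f := fun p : ℝ × α => ENNReal.ofReal (Real.exp (p.1 * f p.2)))
    (by fun_prop)

theorem integrable_exp_iff_expMoment_ne_top {α : Type*} [MeasurableSpace α] {μ : Measure α}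
    {f : α → ℝ} (hf : Measurable f) (u : ℝ) :
    Integrable (fun x => Real.exp (u * f x)) μ ↔ expMoment μ f u ≠ ⊤ :=
  (lintegral_ofReal_ne_top_iff_integrable (by fun_prop)
    (Eventually.of_forall fun _ => (Real.exp_pos _).le)).symm

section Model

variable {Ω₀ : Type*} [MeasurableSpace Ω₀] {P₀ : Measure Ω₀} [IsProbabilityMeasure P₀]
  {C : Ω₀ → ℝ} {T : ℕ → Ω₀ → ℝ}

/-- The law of the generic mark `(C, T)`. -/
noncomputable abbrev markLaw (P₀ : Measure Ω₀) (C : Ω₀ → ℝ) (T : ℕ → Ω₀ → ℝ) : Measure Mark :=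
  P₀.map fun ω => (C ω, fun k => T k ω)

omit [IsProbabilityMeasure P₀] in
theorem measurable_mark (hC : Measurable C) (hT : ∀ k, Measurable (T k)) :
    Measurable fun ω => (C ω, fun k => T k ω) := by fun_prop

theorem expMoment_smoothing_markLaw (hC : Measurable C) (hT : ∀ k, Measurable (T k))
    (h : IsSubcritical (markLaw P₀ C T)) {f g : MarkedTree → ℝ} (hf : Measurable f)
    (hf1 : ∀ u, 1 ≤ expMoment (treeLaw (markLaw P₀ C T)) f u)
    (hg : ∀ᵐ x ∂treeLaw (markLaw P₀ C T),
      g x = (x []).1 + weightedSum (x []).2 fun k => f (subtree k x)) (u : ℝ) :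
    expMoment (treeLaw (markLaw P₀ C T)) g u = ∫⁻ ω, ENNReal.ofReal (Real.exp (u * C ω)) *
      ⨆ N, ∏ k ∈ Finset.range N, expMoment (treeLaw (markLaw P₀ C T)) f (u * T k ω) ∂P₀ := by
  have hm := measurable_mark hC hT
  have : IsProbabilityMeasure (markLaw P₀ C T) := Measure.isProbabilityMeasure_map hm.aemeasurable
  have he := measurable_expMoment (treeLaw (markLaw P₀ C T)) hf
  rw [expMoment_smoothing _ h.finite hf hf1 hg u]
  refine lintegral_map (f := fun e : Mark => ENNReal.ofReal (Real.exp (u * e.1)) *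
    ⨆ N, ∏ k ∈ Finset.range N, expMoment (treeLaw (markLaw P₀ C T)) f (u * e.2 k)) ?_ hm
  refine Measurable.mul (by fun_prop) (Measurable.iSup fun N => ?_)
  exact Finset.measurable_fun_prod _ fun k _ => he.comp (by fun_prop)

/-- Absorbing θ into the innovation reduces a parameter of either sign to the point s = 1 of a
recursion on [0, 1]. -/
theorem isMGFRecursion_iterate (hC : Measurable C) (hT : ∀ k, Measurable (T k))
    (h : IsSubcritical (markLaw P₀ C T)) (θ : ℝ) :
    IsMGFRecursion P₀ (fun ω => θ * C ω) T
      fun n s => expMoment (treeLaw (markLaw P₀ C T)) (iterate n) (s * θ) := by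
  have : IsProbabilityMeasure (markLaw P₀ C T) :=
    Measure.isProbabilityMeasure_map (measurable_mark hC hT).aemeasurable
  have h1 : ∀ n u, 1 ≤ expMoment (treeLaw (markLaw P₀ C T)) (iterate n) u := fun n =>
    one_le_expMoment (h.integrable_iterate n) (h.integral_iterate n)
  refine ⟨fun s => by simp [expMoment, iterate], fun n s => h1 n _, fun n s t ht ht' => ?_,
    fun n s => ?_⟩
  · simp only [mul_assoc t]
    exact expMoment_mul_le (measurable_iterate n) (h1 n _) ht ht'
  · rw [expMoment_smoothing_markLaw hC hT h (measurable_iterate n) (h1 n)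
      (h.ae_root_finite.mono fun x hx => iterate_succ_eq hx n)]
    simp_rw [mul_assoc s, mul_comm θ]

theorem expMoment_limitSolution_ne_top (hC : Measurable C) (hT : ∀ k, Measurable (T k))
    (h : IsSubcritical (markLaw P₀ C T)) {V : Ω₀ → ℝ} {M β : ℝ} (hW : IsDampedWeight P₀ T V M β)
    (hβ : 0 < β) (hβ' : β < 1) (hCm : ∫ ω, C ω ∂P₀ = 0) (hC2 : MemLp C 2 P₀)
    (h_one : P₀ {ω | T 0 ω = 1} < 1) {θ : ℝ}
    (hθ : Integrable (fun ω => Real.exp (θ * C ω)) P₀) (ha : unitWeightMGF P₀ C T θ < 1) :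
    expMoment (treeLaw (markLaw P₀ C T)) limitSolution θ ≠ ⊤ := by
  have : IsProbabilityMeasure (markLaw P₀ C T) :=
    Measure.isProbabilityMeasure_map (measurable_mark hC hT).aemeasurable
  obtain ⟨B, hB⟩ := (isMGFRecursion_iterate hC hT h θ).exists_bound_one hW hβ hβ'
    (by fun_prop) (by rw [integral_const_mul, hCm, mul_zero]) (hC2.const_mul θ) hθ h_one
    (by simpa [unitWeightMGF] using ha)
  simp only [one_mul] at hB
  refine ne_top_of_le_ne_top (ENNReal.ofReal_ne_top (r := B)) ?_
  calc expMoment (treeLaw (markLaw P₀ C T)) limitSolution θ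
      = ∫⁻ x, liminf (fun n => ENNReal.ofReal (Real.exp (θ * iterate n x))) atTop
          ∂treeLaw (markLaw P₀ C T) := by
        refine lintegral_congr_ae ?_
        filter_upwards [h.ae_tendsto] with x hx
        exact (ENNReal.tendsto_ofReal ((Real.continuous_exp.tendsto _).comp
          (hx.const_mul θ))).liminf_eq.symm
    _ ≤ liminf (fun n => expMoment (treeLaw (markLaw P₀ C T)) (iterate n) θ) atTop :=
        lintegral_liminf_le fun n => by
          have := measurable_iterate n
          fun_prop
    _ ≤ _ := liminf_le_of_le (by isBoundedDefault) fun b hb => by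
        obtain ⟨n, hn⟩ := hb.exists
        exact hn.trans (hB n)

theorem lintegral_exp_ne_top_and_unitWeightMGF_lt_one (hC : Measurable C)
    (hT : ∀ k, Measurable (T k)) (h : IsSubcritical (markLaw P₀ C T))
    (h_one : P₀ {ω | T 0 ω = 1} < 1) {θ : ℝ}
    (hθ : expMoment (treeLaw (markLaw P₀ C T)) limitSolution θ ≠ ⊤) :
    expMoment P₀ C θ ≠ ⊤ ∧ unitWeightMGF P₀ C T θ < 1 := by
  have : IsProbabilityMeasure (markLaw P₀ C T) :=
    Measure.isProbabilityMeasure_map (measurable_mark hC hT).aemeasurable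
  have h1 := one_le_expMoment h.integrable_limitSolution h.integral_limitSolution
  have hrec := expMoment_smoothing_markLaw hC hT h measurable_limitSolution h1
    h.limitSolution_fixedPoint θ
  set E := expMoment (treeLaw (markLaw P₀ C T)) limitSolution with hE
  have hge : ∀ N ω, ENNReal.ofReal (Real.exp (θ * C ω)) * ∏ k ∈ Finset.range N, E (θ * T k ω) ≤
      ENNReal.ofReal (Real.exp (θ * C ω)) * ⨆ N, ∏ k ∈ Finset.range N, E (θ * T k ω) :=
    fun N ω => by gcongr; exact le_iSup (fun N => ∏ k ∈ Finset.range N, E (θ * T k ω)) N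
  have hge0 : ∀ ω, ENNReal.ofReal (Real.exp (θ * C ω)) ≤
      ENNReal.ofReal (Real.exp (θ * C ω)) * ⨆ N, ∏ k ∈ Finset.range N, E (θ * T k ω) :=
    fun ω => by simpa using hge 0 ω
  refine ⟨ne_top_of_le_ne_top hθ (hrec ▸ lintegral_mono hge0), ?_⟩
  by_contra! hcon
  set A : Set Ω₀ := {ω | T 0 ω = 1} with hA
  have hAm : MeasurableSet A := measurableSet_eq_fun (hT 0) measurable_const
  -- This positive excess also excludes a(θ) = 1, where the contribution of {T 0 = 1} alone would
  -- give no contradiction.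
  have hpos : 0 < ∫⁻ ω in Aᶜ, ENNReal.ofReal (Real.exp (θ * C ω)) ∂P₀ := by
    rw [setLIntegral_pos_iff (by fun_prop)]
    have : Function.support (fun ω => ENNReal.ofReal (Real.exp (θ * C ω))) = Set.univ := by
      ext ω; simp [Real.exp_pos]
    rw [this, Set.univ_inter, prob_compl_eq_one_sub hAm]
    exact tsub_pos_of_lt h_one
  have hlt : E θ < E θ + ∫⁻ ω in Aᶜ, ENNReal.ofReal (Real.exp (θ * C ω)) ∂P₀ :=
    ENNReal.lt_add_right hθ hpos.ne'
  refine absurd hlt (not_lt.2 ?_)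
  refine le_trans ?_ ((lintegral_add_compl (fun ω => ENNReal.ofReal (Real.exp (θ * C ω)) *
    ⨆ N, ∏ k ∈ Finset.range N, E (θ * T k ω)) hAm).trans hrec.symm).le
  refine add_le_add ?_ (lintegral_mono hge0)
  calc E θ ≤ unitWeightMGF P₀ C T θ * E θ := le_mul_of_one_le_left' hcon
    _ = ∫⁻ ω in A, ENNReal.ofReal (Real.exp (θ * C ω)) * E θ ∂P₀ :=
        (lintegral_mul_const _ (by fun_prop)).symm
    _ ≤ _ := by
        refine setLIntegral_mono' hAm fun ω hω => ?_
        have hω' : T 0 ω = 1 := hω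
        -- The partial product with N = 1 keeps only the factor of T 0 = 1, which is E θ.
        simpa [hω'] using hge 1 ω

end Model

/-! ### The model and its generic marks -/

theorem measurable_powerSum {Ω : Type*} [MeasurableSpace Ω] {T : ℕ → Ω → ℝ}
    (hT : ∀ k, Measurable (T k)) (α : ℝ) : Measurable (powerSum T α) :=
  Measurable.tsum fun k => (hT k).enorm.pow_const α

theorem enorm_rpow_two (x : ℝ) : ‖x‖ₑ ^ (2 : ℝ) = ENNReal.ofReal (x ^ 2) := by
  rw [← sq_abs, ENNReal.ofReal_pow (abs_nonneg _), ← Real.enorm_eq_ofReal_abs]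
  exact_mod_cast ENNReal.rpow_natCast _ 2

theorem enorm_le_one_iff {x : ℝ} : ‖x‖ₑ ≤ 1 ↔ |x| ≤ 1 := by
  rw [Real.enorm_eq_ofReal_abs, ENNReal.ofReal_le_one]

theorem powerSum_two_le {Ω : Type*} {T : ℕ → Ω → ℝ} {ω : Ω} (h : ∀ k, |T k ω| ≤ 1) {p : ℝ}
    (hp : p ≤ 2) : powerSum T 2 ω ≤ powerSum T p ω :=
  ENNReal.tsum_le_tsum fun k => ENNReal.rpow_le_rpow_of_exponent_ge (enorm_le_one_iff.2 (h k)) hp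

theorem exists_forall_ge_eq_zero_of_numNonzero_lt_top {Ω : Type*} {T : ℕ → Ω → ℝ} {ω : Ω}
    (h : numNonzero T ω < ⊤) : ∃ N, ∀ k, N ≤ k → T k ω = 0 := by
  obtain ⟨N, hN⟩ := (Set.encard_lt_top_iff.1 h).bddAbove
  refine ⟨N + 1, fun k hk => ?_⟩
  by_contra hne
  have := hN (show k ∈ {k | T k ω ≠ 0} from hne)
  omega

theorem measurableSet_finite_mark :
    MeasurableSet {e : Mark | ∃ N, ∀ k, N ≤ k → e.2 k = 0} := by
  simp only [Set.ofPred_exists, Set.ofPred_forall]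
  exact MeasurableSet.iUnion fun N => MeasurableSet.iInter fun k => MeasurableSet.iInter fun _ =>
    measurableSet_eq_fun (by fun_prop) measurable_const

theorem isSubcritical_markLaw {Ω₀ : Type*} [MeasurableSpace Ω₀] {P₀ : Measure Ω₀}
    {C : Ω₀ → ℝ} {T : ℕ → Ω₀ → ℝ} (hC : Measurable C) (hT : ∀ k, Measurable (T k))
    (hN : ∀ᵐ ω ∂P₀, numNonzero T ω < ⊤) (hC_mean : ∫ ω, C ω ∂P₀ = 0) (hC_two : MemLp C 2 P₀)
    (hS : ∫⁻ ω, powerSum T 2 ω ∂P₀ < 1) : IsSubcritical (markLaw P₀ C T) := by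
  have hm := measurable_mark hC hT
  refine ⟨?_, ?_, ?_, ?_⟩
  · rw [ae_map_iff hm.aemeasurable measurableSet_finite_mark]
    exact hN.mono fun ω h => exists_forall_ge_eq_zero_of_numNonzero_lt_top h
  · exact (memLp_map_measure_iff (g := fun e : Mark => e.1) (by fun_prop) hm.aemeasurable).2 hC_two
  · rw [integral_map hm.aemeasurable (by fun_prop)]
    exact hC_mean
  · rw [lintegral_map (Measurable.tsum fun k => by fun_prop) hm]
    simpa only [powerSum, enorm_rpow_two] using hS

theorem two_le_numNonzero {Ω : Type*} {T : ℕ → Ω → ℝ} {ω : Ω} {k : ℕ} (h0 : T 0 ω ≠ 0)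
    (hk : T (k + 1) ω ≠ 0) : 2 ≤ numNonzero T ω := by
  rw [← Set.encard_pair (Nat.succ_ne_zero k).symm]
  refine Set.encard_le_encard ?_
  rintro _ (rfl | rfl)
  exacts [h0, hk]

theorem isDampedWeight_of_essSup {Ω₀ : Type*} [MeasurableSpace Ω₀] {P₀ : Measure Ω₀}
    {T : ℕ → Ω₀ → ℝ} (hT : ∀ k, Measurable (T k))
    (hT_nonneg : ∀ᵐ ω ∂P₀, ∀ k, 0 ≤ T k ω) (hT_le_one : ∀ᵐ ω ∂P₀, ∀ k, |T k ω| ≤ 1)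
    (hS : ∫⁻ ω, powerSum T 2 ω ∂P₀ < 1) (hS_two : essSup (powerSum T 2) P₀ < ⊤)
    (h_max : essSup (fun ω => ⨆ k : ℕ, ‖T (k + 1) ω‖ₑ) P₀ < 1)
    (h_one : P₀ {ω | T 0 ω = 1 ∧ 2 ≤ numNonzero T ω} = 0) :
    ∃ β, 0 < β ∧ β < 1 ∧ IsDampedWeight P₀ T (fun ω => (powerSum T 2 ω).toReal)
      (essSup (powerSum T 2) P₀).toReal β := by
  set b := essSup (fun ω => ⨆ k : ℕ, ‖T (k + 1) ω‖ₑ) P₀ with hb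
  have hlt : ∀ᵐ ω ∂P₀, powerSum T 2 ω < ⊤ :=
    (ENNReal.ae_le_essSup (powerSum T 2)).mono fun ω h => h.trans_lt hS_two
  -- The maximum with 1 / 2 makes β positive even if all later weights vanish.
  refine ⟨max b.toReal (1 / 2), by positivity, max_lt ?_ (by norm_num), hT, hT_nonneg,
    hT_le_one.mono fun ω h k => (le_abs_self _).trans (h k), ?_, ?_, ?_, ?_, ?_, ?_⟩
  · simpa using (ENNReal.toReal_lt_toReal h_max.ne_top ENNReal.one_ne_top).2 h_max
  · filter_upwards [ENNReal.ae_le_essSup fun ω => ⨆ k : ℕ, ‖T (k + 1) ω‖ₑ] with ω hω k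
    have h1 : ‖T (k + 1) ω‖ₑ ≤ b := (le_iSup (fun k => ‖T (k + 1) ω‖ₑ) k).trans hω
    have h2 := ENNReal.toReal_mono h_max.ne_top h1
    rw [toReal_enorm, Real.norm_eq_abs] at h2
    exact (le_abs_self _).trans (h2.trans (le_max_left _ _))
  · have : ∀ᵐ ω ∂P₀, ¬(T 0 ω = 1 ∧ 2 ≤ numNonzero T ω) := by
      rw [ae_iff]; simpa only [not_not] using h_one
    filter_upwards [this] with ω hω h0 k
    by_contra hk
    exact hω ⟨h0, two_le_numNonzero (by rw [h0]; exact one_ne_zero) hk⟩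
  · filter_upwards [hlt] with ω hω N
    rw [← ENNReal.ofReal_le_iff_le_toReal hω.ne,
      ENNReal.ofReal_sum_of_nonneg fun _ _ => sq_nonneg _]
    simp only [powerSum, enorm_rpow_two]
    exact ENNReal.sum_le_tsum _
  · exact (measurable_powerSum hT 2).ennreal_toReal.aemeasurable
  · filter_upwards [ENNReal.ae_le_essSup (powerSum T 2)] with ω hω
    exact ENNReal.toReal_mono hS_two.ne hω
  · rw [integral_toReal (measurable_powerSum hT 2).aemeasurable hlt]
    simpa using (ENNReal.toReal_lt_toReal hS.ne_top ENNReal.one_ne_top).2 hS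

/-- On {T 0 = 1} the power sum is at least 1, so Markov's inequality applies. -/
theorem measure_weight_eq_one_lt_one {Ω₀ : Type*} [MeasurableSpace Ω₀] {P₀ : Measure Ω₀}
    {T : ℕ → Ω₀ → ℝ} (hT : ∀ k, Measurable (T k)) (hS : ∫⁻ ω, powerSum T 2 ω ∂P₀ < 1) :
    P₀ {ω | T 0 ω = 1} < 1 := by
  refine lt_of_le_of_lt ?_ hS
  have h := mul_meas_ge_le_lintegral (μ := P₀) (measurable_powerSum hT 2) 1
  rw [one_mul] at h
  refine le_trans (measure_mono fun ω hω => ?_) h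
  have hω' : T 0 ω = 1 := hω
  calc (1 : ENNReal) = ‖T 0 ω‖ₑ ^ (2 : ℝ) := by simp [hω']
    _ ≤ powerSum T 2 ω := ENNReal.le_tsum (f := fun k => ‖T k ω‖ₑ ^ (2 : ℝ)) 0

theorem IsBranchingModel.measurePreserving {Ω₀ Ω : Type*} [MeasurableSpace Ω₀] [MeasurableSpace Ω]
    {P₀ : Measure Ω₀} {P : Measure Ω} {C : Ω₀ → ℝ} {T : ℕ → Ω₀ → ℝ} {CC : List ℕ → Ω → ℝ}
    {TT : List ℕ → ℕ → Ω → ℝ} (h : IsBranchingModel P₀ C T P CC TT) :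
    MeasurePreserving (fun ω (v : List ℕ) => (CC v ω, fun k => TT v k ω)) P
      (treeLaw (markLaw P₀ C T)) := by
  have hm : ∀ v, Measurable fun ω => (CC v ω, fun k => TT v k ω) := fun v =>
    (h.measurable_C v).prodMk (measurable_pi_lambda _ fun k => h.measurable_T v k)
  refine ⟨measurable_pi_lambda _ hm, ?_⟩
  rw [h.indep.map_fun_eq_infinitePi_map hm]
  simp_rw [(h.identDistrib _).map_eq]

end SmoothingTransform

/-! ### Transfer from the tree law to the given branching model -/

theorem theorem3p4
    {Ω₀ Ω : Type*} [MeasurableSpace Ω₀] [MeasurableSpace Ω]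
    (P₀ : Measure Ω₀) [IsProbabilityMeasure P₀]
    (P : Measure Ω) [IsProbabilityMeasure P]
    -- the generic sequence `(C, T_1, T_2, ...)`
    (C : Ω₀ → ℝ) (T : ℕ → Ω₀ → ℝ)
    (hC : Measurable C) (hT : ∀ k, Measurable (T k))
    (hN : ∀ᵐ ω ∂P₀, SmoothingTransform.numNonzero T ω < ⊤)
    (hT_nonneg : ∀ᵐ ω ∂P₀, ∀ k, 0 ≤ T k ω)
    (hT_anti : ∀ᵐ ω ∂P₀, Antitone (fun k => T k ω))
    (hT_le_one : ∀ᵐ ω ∂P₀, ∀ k, |T k ω| ≤ 1)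
    -- moment conditions
    (p : ℝ) (hp : p ∈ Set.Icc (1 : ℝ) 2)
    (hC_mean : ∫ ω, C ω ∂P₀ = 0)
    (hC_p : MemLp C (ENNReal.ofReal p) P₀)
    (hS_p : ∫⁻ ω, SmoothingTransform.powerSum T p ω ∂P₀ < 1)
    (hC_two : MemLp C 2 P₀)
    (hS_two : essSup (SmoothingTransform.powerSum T 2) P₀ < ⊤)
    -- only `T_1` can be close to `1`, and `T_1 = 1` only if `N = 1`
    (h_max : essSup (fun ω => ⨆ k : ℕ, ‖T (k + 1) ω‖ₑ) P₀ < 1)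
    (h_one : P₀ {ω | T 0 ω = 1 ∧ 2 ≤ SmoothingTransform.numNonzero T ω} = 0)
    -- the weighted branching model
    (CC : List ℕ → Ω → ℝ) (TT : List ℕ → ℕ → Ω → ℝ)
    (hmodel : SmoothingTransform.IsBranchingModel P₀ C T P CC TT) :
    (∀ᵐ ω ∂P, Tendsto (fun n => SmoothingTransform.partialSolution CC TT n ω) atTop
      (𝓝 (SmoothingTransform.canonicalSolution CC TT ω))) ∧
    integrableExpSet (SmoothingTransform.canonicalSolution CC TT) P =
      integrableExpSet C P₀ ∩ {θ : ℝ | SmoothingTransform.unitWeightMGF P₀ C T θ < 1} := by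
  have hS : ∫⁻ ω, SmoothingTransform.powerSum T 2 ω ∂P₀ < 1 :=
    lt_of_le_of_lt (lintegral_mono_ae (hT_le_one.mono fun ω h =>
      SmoothingTransform.powerSum_two_le h hp.2)) hS_p
  have hsub := SmoothingTransform.isSubcritical_markLaw hC hT hN hC_mean hC_two hS
  obtain ⟨β, hβ, hβ', hW⟩ := SmoothingTransform.isDampedWeight_of_essSup hT hT_nonneg hT_le_one hS
    hS_two h_max h_one
  have hlt := SmoothingTransform.measure_weight_eq_one_lt_one hT hS
  have hmp := hmodel.measurePreserving
  have : IsProbabilityMeasure (SmoothingTransform.markLaw P₀ C T) :=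
    Measure.isProbabilityMeasure_map (SmoothingTransform.measurable_mark hC hT).aemeasurable
  have hfin : ∀ᵐ ω ∂P, ∀ v, ∃ N, ∀ k, N ≤ k → TT v k ω = 0 := by
    refine ae_all_iff.2 fun v => ?_
    exact ((measurePreserving_eval_infinitePi (fun _ : List ℕ =>
      SmoothingTransform.markLaw P₀ C T) v).comp hmp).quasiMeasurePreserving.ae hsub.finite
  have hlim : ∀ᵐ ω ∂P, Tendsto (fun n => SmoothingTransform.partialSolution CC TT n ω) atTop
      (𝓝 (SmoothingTransform.limitSolution fun v => (CC v ω, fun k => TT v k ω))) := by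
    filter_upwards [hfin, hmp.quasiMeasurePreserving.ae hsub.ae_tendsto] with ω h1 h2
    -- W_n includes generation n, whereas `iterate n` stops before it; hence the shift by one.
    refine (h2.comp (tendsto_add_atTop_nat 1)).congr fun n => ?_
    simp only [Function.comp_apply, SmoothingTransform.iterate, SmoothingTransform.partialSolution]
    exact Finset.sum_congr rfl fun k _ => (SmoothingTransform.generationSum_eq k CC TT h1).symm
  have hcan : SmoothingTransform.canonicalSolution CC TT =ᵐ[P] fun ω =>
      SmoothingTransform.limitSolution fun v => (CC v ω, fun k => TT v k ω) :=
    hlim.mono fun ω h => h.limUnder_eq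
  refine ⟨?_, ?_⟩
  · filter_upwards [hlim, hcan] with ω h1 h2
    rwa [h2]
  · ext θ
    have hiff : θ ∈ integrableExpSet (SmoothingTransform.canonicalSolution CC TT) P ↔
        SmoothingTransform.expMoment (SmoothingTransform.treeLaw
          (SmoothingTransform.markLaw P₀ C T)) SmoothingTransform.limitSolution θ ≠ ⊤ := by
      have hmeas := SmoothingTransform.measurable_limitSolution
      rw [← SmoothingTransform.integrable_exp_iff_expMoment_ne_top hmeas,
        ← hmp.integrable_comp (by fun_prop)]
      exact integrable_congr (hcan.mono fun ω h => by simp only [h, Function.comp])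
    have hiffC : θ ∈ integrableExpSet C P₀ ↔ SmoothingTransform.expMoment P₀ C θ ≠ ⊤ :=
      SmoothingTransform.integrable_exp_iff_expMoment_ne_top hC θ
    rw [hiff, Set.mem_inter_iff]
    constructor
    · intro h
      have := SmoothingTransform.lintegral_exp_ne_top_and_unitWeightMGF_lt_one hC hT hsub hlt h
      exact ⟨hiffC.2 this.1, this.2⟩
    · rintro ⟨h1, h2⟩
      exact SmoothingTransform.expMoment_limitSolution_ne_top hC hT hsub hW hβ hβ' hC_mean hC_two
        hlt h1 h2
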